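/- Let $\mathcal K$ be a finite-dimensional complex Hilbert space, $n=\dim\mathcal K$, and equip $\mathcal K\oplus\mathcal K$ with the symplectic form $\omega(u,v)=\langle u_0,v_1\rangle-\langle u_1,v_0\rangle$ for $u=(u_0,u_1)$, $v=(v_0,v_1)$, where the inner product is conjugate linear in its first argument. A subspace is Lagrangian if it equals its symplectic complement. The Lagrangian Grassmannian $\Lambda$ is the set of Lagrangian subspaces, with the gap metric $\|P_{\mathcal L}-P_{\mathcal M}\|$ ($P$ denoting orthogonal projections) and its usual smooth structure. A differentiable path $\mathcal L(\cdot)$ in $\Lambda$ is increasing if at each $t_0$ the crossing form $\mathfrak q(u,v)=\frac{d}{dt}\omega(u,\tilde v(t))|_{t=t_0}$ on $\mathcal L(t_0)$ is positive definite, where $\tilde v$ is any differentiable path with $\tilde v(t_0)=v$ and $\tilde v(t)\in\mathcal L(t)$ for $t$ near $t_0$. For Lagrangian $\alpha,\beta,\gamma$ with $\alpha\cap\beta=0=\beta\cap\gamma$, write $\gamma=\{u+Lu:u\in\alpha\}$ with $L\colon\alpha\to\beta$ linear, and put $Q(\alpha,\beta;\gamma)(u_1,u_2)=\omega(u_1,Lu_2)$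 on $\alpha$. The Duistermaat index is $$\iota(\mathcal L_1,\mathcal L_2,\mathcal L_3)=n_-\big(Q(\mathcal L_2,\hat{\mathcal L};\mathcal L_3)\big)-n_-\big(Q(\mathcal L_1,\hat{\mathcal L};\mathcal L_3)\big)+n_-\big(Q(\mathcal L_1,\hat{\mathcal L};\mathcal L_2)\big),$$ where $\hat{\mathcal L}$ is any Lagrangian subspace transversal to all three and $n_-$ is the maximal dimension of a subspace on which the form is negative definite. Theorem. Suppose $\mathcal L\colon(-1,1)\to\Lambda$ is a continuous path that is differentiable and increasing on $(-1,0)\cup(0,1)$, and set $\mathcal L_0:=\mathcal L(0)$. For any $\mathcal L_1,\mathcal L_2,\mathcal L_3\in\Lambda$ there is $\varepsilon>0$ such that for all $t$ with $0<|t|<\varepsilon$: $$\iota(\mathcal L(t),\mathcal L_2,\mathcal L_3)=\iota(\mathcal L_0,\mathcal L_2,\mathcal L_3)+\begin{cases}0,&t<0,\\ \dim\mathcal L_2\cap\mathcal L_0-\dim\mathcal L_3\cap\mathcal L_0,&t>0,\end{cases}\;=\begin{cases}\iota(\mathcal L_0,\mathcal L_2,\mathcal L_3),&t<0,\\ \iota(\mathcal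 L_2,\mathcal L_3,\mathcal L_0),&t>0,\end{cases}$$ $$\iota(\mathcal L_1,\mathcal L(t),\mathcal L_3)=\iota(\mathcal L_1,\mathcal L_0,\mathcal L_3)+\begin{cases}\dim\mathcal L_1\cap\mathcal L_0,&t<0,\\ \dim\mathcal L_3\cap\mathcal L_0,&t>0,\end{cases}$$ $$\iota(\mathcal L_1,\mathcal L_2,\mathcal L(t))=\iota(\mathcal L_1,\mathcal L_2,\mathcal L_0)+\begin{cases}\dim\mathcal L_2\cap\mathcal L_0-\dim\mathcal L_1\cap\mathcal L_0,&t<0,\\ 0,&t>0,\end{cases}\;=\begin{cases}\iota(\mathcal L_0,\mathcal L_1,\mathcal L_2),&t<0,\\ \iota(\mathcal L_1,\mathcal L_2,\mathcal L_0),&t>0.\end{cases}$$ In particular, $t\mapsto\iota(\mathcal L(t),\mathcal L_2,\mathcal L_3)$ is left-continuous at $0$ and $t\mapsto\iota(\mathcal L_1,\mathcal L_2,\mathcal L(t))$ is right-continuous at $0$. -/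

import Mathlib

open Filter Topology

namespace Duistermaat

/-- The space `K ⊕ K` with its Hilbert space structure. -/
abbrev Phase (K : Type*) := WithLp 2 (K × K)

section

variable {K : Type*} [NormedAddCommGroup K] [InnerProductSpace ℂ K]

/-- The symplectic form `ω(u, v) = ⟨u₀, v₁⟩ - ⟨u₁, v₀⟩`; it is conjugate linear in `u` and
linear in `v`, as is Mathlib's inner product. -/
noncomputable def omega (u v : Phase K) : ℂ := inner ℂ u.fst v.snd - inner ℂ u.snd v.fst

/-- The operator `J (u₀, u₁) = (u₁, -u₀)`. -/
def J : Phase K →ₗ[ℂ] Phase K where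
  toFun u := WithLp.toLp 2 (u.snd, -u.fst)
  map_add' u v := by
    apply WithLp.ofLp_injective
    ext <;> simp [add_comm]
  map_smul' c u := by
    apply WithLp.ofLp_injective
    ext <;> simp

theorem omega_eq_inner (u v : Phase K) : omega u v = inner ℂ u (J v) := by
  simp [omega, J, WithLp.prod_inner_apply, sub_eq_add_neg]

/-- The symplectic complement `{u | ω(u, v) = 0 for all v ∈ S}`. -/
def sympCompl (S : Submodule ℂ (Phase K)) : Submodule ℂ (Phase K) where
  carrier := {u | ∀ v ∈ S, omega u v = 0}
  add_mem' := by
    intro a b ha hb v hv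
    have h1 := ha v hv
    have h2 := hb v hv
    rw [omega_eq_inner] at *
    rw [inner_add_left, h1, h2, add_zero]
  zero_mem' := by
    intro v _
    rw [omega_eq_inner, inner_zero_left]
  smul_mem' := by
    intro c a ha v hv
    have h1 := ha v hv
    rw [omega_eq_inner] at *
    rw [inner_smul_left, h1, mul_zero]

theorem mem_sympCompl {S : Submodule ℂ (Phase K)} {u : Phase K} :
    u ∈ sympCompl S ↔ ∀ v ∈ S, omega u v = 0 := Iff.rfl

/-- The negative index of a form `Q` on a finite-dimensional complex vector space `V`: the maximal
dimension of a subspace on which `Q` is negative definite. (For a Hermitian form, `Q x x` is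
real.) -/
noncomputable def negIndex {V : Type*} [AddCommGroup V] [Module ℂ V] (Q : V → V → ℂ) : ℕ :=
  sSup {d : ℕ | ∃ W : Submodule ℂ V, Module.finrank ℂ W = d ∧ ∀ x ∈ W, x ≠ 0 → (Q x x).re < 0}

end

/-- The Lagrangian Grassmannian of `K ⊕ K`: subspaces that equal their symplectic complement. -/
@[ext] structure Lagr (K : Type*) [NormedAddCommGroup K] [InnerProductSpace ℂ K] where
  /-- the underlying subspace -/
  plane : Submodule ℂ (Phase K)
  isLagrangian : sympCompl plane = plane

section

variable {K : Type*} [NormedAddCommGroup K] [InnerProductSpace ℂ K]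

theorem Lagr.omega_eq_zero (L : Lagr K) {u v : Phase K} (hu : u ∈ L.plane) (hv : v ∈ L.plane) :
    omega u v = 0 := by
  have h := L.isLagrangian
  rw [← h] at hu
  exact hu v hv

/-- The coordinate map `Ψ_L(A) = {v + J A v : v ∈ L}`, for an operator `A` on `L`. -/
def graphChart (L : Submodule ℂ (Phase K)) (A : L →L[ℂ] L) : Submodule ℂ (Phase K) :=
  LinearMap.range (L.subtype + J ∘ₗ L.subtype ∘ₗ (A : L →ₗ[ℂ] L))

/-- Differentiability at `t₀` of a path in the Lagrangian Grassmannian, as a manifold: in the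
coordinate chart `Ψ_L` centred at `L = 𝓛(t₀)`, whose domain is the space of self-adjoint operators
on `L`, the path is given near `t₀` by a family of operators that is differentiable at `t₀`. -/
def PathDifferentiableAt (L : ℝ → Lagr K) (t₀ : ℝ) : Prop :=
  ∃ A : ℝ → ((L t₀).plane →L[ℂ] (L t₀).plane), DifferentiableAt ℝ A t₀ ∧
    ∀ᶠ t in 𝓝 t₀, (A t : (L t₀).plane →ₗ[ℂ] (L t₀).plane).IsSymmetric ∧
      (L t).plane = graphChart (L t₀).plane (A t)

/-- `w` is differentiable at `t₀`, and `w t ∈ 𝓛(t)` for all `t` near `t₀`. -/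
def IsLocalSection (L : ℝ → Lagr K) (t₀ : ℝ) (w : ℝ → Phase K) : Prop :=
  DifferentiableAt ℝ w t₀ ∧ ∀ᶠ t in 𝓝 t₀, w t ∈ (L t).plane

open Classical in
/-- The crossing form `𝔮(u, v) = d/dt ω(u, w(t))` at `t = t₀`, where `w` is any local section of
the path with `w(t₀) = v`. For a differentiable path such sections exist and all give the same
value, see `exists_isLocalSection` and `crossingForm_eq`. -/
noncomputable def crossingForm (L : ℝ → Lagr K) (t₀ : ℝ) (u v : Phase K) : ℂ :=
  if h : ∃ w, IsLocalSection L t₀ w ∧ w t₀ = v then deriv (fun t => omega u (h.choose t)) t₀ else 0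

/-- The path is increasing on `S`: its crossing form is positive (definite) at each point of
`S`. -/
def IsIncreasingOn (L : ℝ → Lagr K) (S : Set ℝ) : Prop :=
  ∀ t₀ ∈ S, ∀ v ∈ (L t₀).plane, v ≠ 0 → 0 < (crossingForm L t₀ v v).re

/-- For `β` and `γ` complementary, the linear map `α → β` sending `u` to the unique
element `b` of `β` with `u + b ∈ γ`. -/
noncomputable def graphMap (α β γ : Submodule ℂ (Phase K)) (h : IsCompl β γ) : α →ₗ[ℂ] β :=
  -(β.projectionOnto γ h ∘ₗ α.subtype)

/-- If also `α` and `β` are complementary, then `γ` is the graph of `graphMap α β γ`. -/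
theorem mem_iff_graphMap {α β γ : Submodule ℂ (Phase K)} (h : IsCompl β γ) (h' : IsCompl α β)
    (x : Phase K) :
    x ∈ γ ↔ ∃ u : α, x = u + graphMap α β γ h u := by
  have key : ∀ u : α, (u : Phase K) + graphMap α β γ h u ∈ γ := by
    intro u
    have := Submodule.projectionOnto_apply_eq_zero_iff h
      (x := (u : Phase K) + graphMap α β γ h u)
    rw [← this, map_add]
    change β.projectionOnto γ h u + β.projectionOnto γ h
      ((-(β.projectionOnto γ h u) : β) : Phase K) = 0
    rw [Submodule.projectionOnto_apply_left, add_neg_cancel]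
  constructor
  · intro hx
    have hx' : x ∈ α ⊔ β := by rw [h'.sup_eq_top]; trivial
    obtain ⟨a, ha, b, hb, rfl⟩ := Submodule.mem_sup.1 hx'
    refine ⟨⟨a, ha⟩, ?_⟩
    have h1 := γ.sub_mem hx (key ⟨a, ha⟩)
    have h2 : b - (graphMap α β γ h ⟨a, ha⟩ : Phase K) ∈ γ := by
      convert h1 using 1
      simp
    have h3 := Submodule.disjoint_def.1 h.disjoint _
      (β.sub_mem hb (graphMap α β γ h ⟨a, ha⟩).2) h2
    rw [sub_eq_zero.1 h3]
  · rintro ⟨u, rfl⟩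
    exact key u

/-- The form `Q(α, β; γ)(u₁, u₂) = ω(u₁, L u₂)` on `α`, where `L : α → β` has graph `γ`. -/
noncomputable def formQ (α β γ : Submodule ℂ (Phase K)) (h : IsCompl β γ) (u₁ u₂ : α) : ℂ :=
  omega (u₁ : Phase K) (graphMap α β γ h u₂ : Phase K)

/-- Transversality of Lagrangian planes: they intersect only in `0`. -/
def Transversal (L M : Lagr K) : Prop := L.plane ⊓ M.plane = ⊥

/-- The plane `{(x, s x)}`, for real `s`. -/
def slopePlane (K : Type*) [NormedAddCommGroup K] [InnerProductSpace ℂ K] (s : ℝ) : Lagr K where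
  plane :=
    { carrier := {u | u.snd = (s : ℂ) • u.fst}
      add_mem' := by
        intro a b ha hb
        simp only [Set.mem_ofPred_eq] at *
        simp [ha, hb]
      zero_mem' := by simp
      smul_mem' := by
        intro c a ha
        simp only [Set.mem_ofPred_eq] at *
        simp [ha, smul_comm c] }
  isLagrangian := by
    ext u
    rw [mem_sympCompl]
    constructor
    · intro hu
      change u.snd = (s : ℂ) • u.fst
      have h : inner ℂ ((s : ℂ) • u.fst - u.snd) ((s : ℂ) • u.fst - u.snd) = 0 := by
        have h1 := hu (WithLp.toLp 2 ((s : ℂ) • u.fst - u.snd, (s : ℂ) • ((s : ℂ) • u.fst - u.snd)))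
          rfl
        change inner ℂ u.fst ((s : ℂ) • ((s : ℂ) • u.fst - u.snd))
          - inner ℂ u.snd ((s : ℂ) • u.fst - u.snd) = 0 at h1
        rw [inner_smul_right] at h1
        nth_rewrite 1 [inner_sub_left]
        rw [inner_smul_left, Complex.conj_ofReal]
        exact h1
      exact (sub_eq_zero.1 (inner_self_eq_zero.1 h)).symm
    · intro hu v hv
      have hu' : u.snd = (s : ℂ) • u.fst := hu
      have hv' : v.snd = (s : ℂ) • v.fst := hv
      rw [omega, hu', hv', inner_smul_left, inner_smul_right, Complex.conj_ofReal, sub_self]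

variable [FiniteDimensional ℂ K]

instance : FiniteDimensional ℂ (Phase K) :=
  (WithLp.linearEquiv 2 ℂ (K × K)).symm.finiteDimensional

/-- The gap metric `d(L, M) = ‖P_L - P_M‖`. -/
noncomputable instance : MetricSpace (Lagr K) :=
  MetricSpace.induced (fun L : Lagr K => L.plane.starProjection)
    (by
      intro L M h
      have h' : L.plane.starProjection = M.plane.starProjection := h
      have h2 := congrArg (fun f : Phase K →L[ℂ] Phase K => f.range) h'
      simp only [Submodule.range_starProjection] at h2
      exact Lagr.ext h2)
    inferInstance

/-- Lagrangian planes that intersect only in `0` are complementary. -/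
theorem Transversal.isCompl {L M : Lagr K} (h : Transversal L M) : IsCompl L.plane M.plane := by
  refine ⟨disjoint_iff.2 h, codisjoint_iff.2 ?_⟩
  rw [← Submodule.orthogonal_eq_bot_iff, Submodule.eq_bot_iff]
  intro w hw
  have hz : ∀ v ∈ L.plane ⊔ M.plane, omega (J w) v = 0 := by
    intro v hv
    have h1 : inner ℂ w v = 0 := Submodule.inner_left_of_mem_orthogonal hv hw
    rw [← h1]
    simp [omega, J, WithLp.prod_inner_apply, add_comm]
  have hL : J w ∈ L.plane := by
    rw [← L.isLagrangian]
    exact fun v hv => hz v (Submodule.mem_sup_left hv)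
  have hM : J w ∈ M.plane := by
    rw [← M.isLagrangian]
    exact fun v hv => hz v (Submodule.mem_sup_right hv)
  have h0 : J w = 0 := by
    have : J w ∈ L.plane ⊓ M.plane := ⟨hL, hM⟩
    rw [h] at this
    exact (Submodule.mem_bot ℂ).1 this
  have h1 : (J w).fst = 0 := by rw [h0]; rfl
  have h2 : (J w).snd = 0 := by rw [h0]; rfl
  apply WithLp.ofLp_injective
  ext
  · simpa [J] using h2
  · simpa [J] using h1

theorem finite_not_transversal (L : Lagr K) :
    {s : ℝ | ¬ Transversal (slopePlane K s) L}.Finite := by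
  have hex : ∀ s : {s : ℝ | ¬ Transversal (slopePlane K s) L},
      ∃ x : K, x ≠ 0 ∧ WithLp.toLp 2 (x, ((s : ℝ) : ℂ) • x) ∈ L.plane := by
    rintro ⟨s, hs⟩
    obtain ⟨u, hu, hu0⟩ := (Submodule.ne_bot_iff _).1 hs
    have h1 : u.snd = (s : ℂ) • u.fst := hu.1
    have h2 : u = WithLp.toLp 2 (u.fst, (s : ℂ) • u.fst) := by
      rw [← h1]
      rfl
    refine ⟨u.fst, ?_, ?_⟩
    · intro h
      apply hu0
      rw [h2, h]
      simp
    · rw [← h2]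
      exact hu.2
  choose x hx0 hxL using hex
  have hind : LinearIndependent ℂ x := by
    refine linearIndependent_of_ne_zero_of_inner_eq_zero hx0 ?_
    intro i j hij
    have h := L.omega_eq_zero (hxL i) (hxL j)
    change inner ℂ (x i) (((j : ℝ) : ℂ) • x j) - inner ℂ (((i : ℝ) : ℂ) • x i) (x j) = 0 at h
    rw [inner_smul_left, inner_smul_right, Complex.conj_ofReal, ← sub_mul] at h
    refine (mul_eq_zero.1 h).resolve_left ?_
    intro h'
    apply hij
    have h3 : ((j : ℝ) : ℂ) = ((i : ℝ) : ℂ) := sub_eq_zero.1 h'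
    exact Subtype.ext (Complex.ofReal_injective h3).symm
  have hf := hind.finite
  exact Set.toFinite _

/-- Any three Lagrangian planes have a common transversal Lagrangian plane. -/
theorem exists_transversal (L₁ L₂ L₃ : Lagr K) :
    ∃ M : Lagr K, Transversal M L₁ ∧ Transversal M L₂ ∧ Transversal M L₃ := by
  obtain ⟨s, hs⟩ := (((finite_not_transversal L₁).union (finite_not_transversal L₂)).union
    (finite_not_transversal L₃)).infinite_compl.nonempty
  simp only [Set.mem_compl_iff, Set.mem_union, Set.mem_ofPred_eq, not_or, not_not] at hs
  exact ⟨slopePlane K s, hs.1.1, hs.1.2, hs.2⟩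

/-- The Duistermaat index computed with the auxiliary plane `M` transversal to `L₂` and `L₃`
(and to `L₁`):
`n₋(Q(L₂, M; L₃)) - n₋(Q(L₁, M; L₃)) + n₋(Q(L₁, M; L₂))`. -/
noncomputable def indexVia (L₁ L₂ L₃ M : Lagr K) (h₂ : Transversal M L₂) (h₃ : Transversal M L₃) :
    ℤ :=
  (negIndex (formQ L₂.plane M.plane L₃.plane h₃.isCompl) : ℤ)
    - negIndex (formQ L₁.plane M.plane L₃.plane h₃.isCompl)
    + negIndex (formQ L₁.plane M.plane L₂.plane h₂.isCompl)

/-- The Duistermaat index `ι(L₁, L₂, L₃)`, for some choice of a Lagrangian plane transversal to all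
three. -/
noncomputable def iota (L₁ L₂ L₃ : Lagr K) : ℤ :=
  indexVia L₁ L₂ L₃ (exists_transversal L₁ L₂ L₃).choose
    (exists_transversal L₁ L₂ L₃).choose_spec.2.1 (exists_transversal L₁ L₂ L₃).choose_spec.2.2

/-- `dim (L ∩ M)`, as an integer. -/
noncomputable def dimInter (L M : Lagr K) : ℤ :=
  (Module.finrank ℂ (L.plane ⊓ M.plane : Submodule ℂ (Phase K)) : ℤ)

theorem exists_isLocalSection {L : ℝ → Lagr K} {t₀ : ℝ} (hL : PathDifferentiableAt L t₀)
    {v : Phase K} (hv : v ∈ (L t₀).plane) : ∃ w, IsLocalSection L t₀ w ∧ w t₀ = v := by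
  obtain ⟨A, hA, hAL⟩ := hL
  -- the coordinate of the centre of the chart is `0`
  have hA0 : ∀ x : (L t₀).plane, A t₀ x = 0 := by
    intro x
    have h0 := hAL.self_of_nhds.2
    have hx : (x : Phase K) + J (A t₀ x : Phase K) ∈ (L t₀).plane := by
      exact h0.ge ⟨x, rfl⟩
    have hJ : J (A t₀ x : Phase K) ∈ (L t₀).plane := by
      simpa using (L t₀).plane.sub_mem hx x.2
    have h1 := (L t₀).omega_eq_zero hJ (A t₀ x).2
    have h2 : omega (J (A t₀ x : Phase K)) (A t₀ x : Phase K)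
        = inner ℂ (A t₀ x : Phase K) (A t₀ x : Phase K) := by
      rw [WithLp.prod_inner_apply]
      simp [omega, J, add_comm]
    rw [h2] at h1
    exact Subtype.ext (inner_self_eq_zero.1 h1)
  refine ⟨fun t => v + LinearMap.toContinuousLinearMap J
    ((L t₀).plane.subtypeL (A t ⟨v, hv⟩)), ⟨?_, ?_⟩, ?_⟩
  · have hg : DifferentiableAt ℝ (fun B : (L t₀).plane →L[ℂ] (L t₀).plane =>
        LinearMap.toContinuousLinearMap J ((L t₀).plane.subtypeL (B ⟨v, hv⟩))) (A t₀) :=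
      (((LinearMap.toContinuousLinearMap (J (K := K))).comp ((L t₀).plane.subtypeL.comp
        (ContinuousLinearMap.apply ℂ (L t₀).plane (⟨v, hv⟩ : (L t₀).plane)))).restrictScalars
        ℝ).differentiableAt
    have h2 := DifferentiableAt.comp (𝕜 := ℝ) (E := ℝ)
      (F := (L t₀).plane →L[ℂ] (L t₀).plane) t₀ hg hA
    exact h2.const_add v
  · filter_upwards [hAL] with t ht
    rw [ht.2]
    exact ⟨⟨v, hv⟩, rfl⟩
  · simp [hA0]

theorem hasDerivAt_omega {u w : ℝ → Phase K} {t₀ : ℝ} {u' w' : Phase K} (hu : HasDerivAt u u' t₀)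
    (hw : HasDerivAt w w' t₀) :
    HasDerivAt (fun t => omega (u t) (w t)) (omega (u t₀) w' + omega u' (w t₀)) t₀ := by
  have h := ((LinearMap.toContinuousLinearMap (J (K := K))).restrictScalars
    ℝ).hasFDerivAt.comp_hasDerivAt t₀ hw
  have h2 := HasDerivAt.inner ℂ hu h
  simp only [omega_eq_inner]
  exact h2

theorem crossingForm_eq {L : ℝ → Lagr K} {t₀ : ℝ} (hL : PathDifferentiableAt L t₀)
    {u v : Phase K} (hu : u ∈ (L t₀).plane) {w : ℝ → Phase K} (hw : IsLocalSection L t₀ w)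
    (hwv : w t₀ = v) : crossingForm L t₀ u v = deriv (fun t => omega u (w t)) t₀ := by
  obtain ⟨x, hx, hxu⟩ := exists_isLocalSection hL hu
  have key : ∀ y, IsLocalSection L t₀ y → y t₀ = v →
      deriv (fun t => omega u (y t)) t₀ = - omega (deriv x t₀) v := by
    intro y hy hyv
    have h1 := hasDerivAt_omega hx.1.hasDerivAt hy.1.hasDerivAt
    have h2 : (fun t => omega (x t) (y t)) =ᶠ[𝓝 t₀] fun _ => 0 := by
      filter_upwards [hx.2, hy.2] with t ha hb
      exact (L t).omega_eq_zero ha hb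
    have h3 := h1.unique ((hasDerivAt_const t₀ (0 : ℂ)).congr_of_eventuallyEq h2)
    have h4 := (hasDerivAt_omega (hasDerivAt_const t₀ u) hy.1.hasDerivAt).deriv
    rw [h4]
    rw [hxu, hyv] at h3
    have h5 : omega (0 : Phase K) (y t₀) = 0 := by rw [omega_eq_inner, inner_zero_left]
    rw [h5, add_zero]
    exact eq_neg_of_add_eq_zero_left h3
  have h : ∃ y, IsLocalSection L t₀ y ∧ y t₀ = v := ⟨w, hw, hwv⟩
  rw [crossingForm, dif_pos h, key _ h.choose_spec.1 h.choose_spec.2, key w hw hwv]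

end

end Duistermaat

/-! Fix a Lagrangian plane `M` transversal to `L 0` and to the three given planes. Over the base `B
= L 0`, every Lagrangian plane transversal to `M` is the graph of a map `B → M`, hence is encoded by
a self-adjoint operator on `B` (`chartOp`), with `L 0` encoded by `0`. The form `Q(L, M; L')` is
congruent to the difference `T' - T` of the operators (`negIndex_formQ`), and `dim L ∩ L'` is the
nullity of that difference. So the index becomes `n₋(T₃ - T₂) - n₋(T₃ - T₁) + n₋(T₂ - T₁)`.

The definition allows a different auxiliary plane for each `t`, so independence of `M` is essential.
It comes from the Kashiwara form, which does not involve `M`: its negative index is `n₋(T₂ - T₁) +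
n₋(T₃ - T₂) + n₋(T₁ - T₃)`, and this differs from the index by `n - dim L₁ ∩ L₃`
(`indexVia_eq_of_transversal`).

Along the path, the operator of `L t` tends to `0`, and its quadratic form has the crossing form as
derivative. It is therefore small, positive definite for `t > 0` and negative definite for `t < 0`
(`eventually_sign_chartOp`, `eventually_chartOp_le`). A small positive perturbation keeps `n₋`, and
a small negative one adds the nullity (`exists_opNegIndex_perturbation`). The formulas then follow
by integer arithmetic from `n₋(T) + n₋(-T) + dim ker T = n`. -/

namespace Duistermaat

/-! ### Negative index certified by a splitting. -/

section NegIndex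

variable {V W : Type*} [AddCommGroup V] [Module ℂ V] [AddCommGroup W] [Module ℂ W]

/-- A splitting of `V`, by dimension, into a subspace of dimension `k` on which `q` is negative
definite and a subspace on which `q` is nonnegative. -/
def HasNegIndex (q : V → ℝ) (k : ℕ) : Prop :=
  ∃ N P : Submodule ℂ V, Module.finrank ℂ N = k ∧
    Module.finrank ℂ N + Module.finrank ℂ P = Module.finrank ℂ V ∧
    (∀ x ∈ N, x ≠ 0 → q x < 0) ∧ ∀ x ∈ P, 0 ≤ q x

/-- A negative definite subspace meets `P` only in `0`, so its dimension is at most `dim V - dim P =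
k`, and `N` attains this. -/
theorem HasNegIndex.negIndex_eq [FiniteDimensional ℂ V] {Q : V → V → ℂ} {k : ℕ}
    (h : HasNegIndex (fun x => (Q x x).re) k) : negIndex Q = k := by
  obtain ⟨N, P, hk, hd, hN, hP⟩ := h
  refine IsGreatest.csSup_eq ⟨⟨N, hk, hN⟩, ?_⟩
  rintro d ⟨U, rfl, hU⟩
  have hdis : Disjoint U P := by
    rw [Submodule.disjoint_def]
    intro x hxU hxP
    by_contra hx
    exact absurd (hU x hxU hx) (not_lt.2 (hP x hxP))
  have := Submodule.finrank_add_finrank_le_of_disjoint hdis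
  omega

/-- Sylvester's law of inertia, used to compare two charts. Since `negIndex` reads only the
diagonal, a form that ignores its second argument suffices. -/
theorem HasNegIndex.unique [FiniteDimensional ℂ V] {q : V → ℝ} {k l : ℕ}
    (h : HasNegIndex q k) (h' : HasNegIndex q l) : k = l := by
  have h1 : negIndex (fun x _ : V => (q x : ℂ)) = k := HasNegIndex.negIndex_eq (by simpa using h)
  have h2 : negIndex (fun x _ : V => (q x : ℂ)) = l := HasNegIndex.negIndex_eq (by simpa using h')
  exact h1.symm.trans h2

theorem HasNegIndex.of_equiv {q : V → ℝ} {k : ℕ} (e : V ≃ₗ[ℂ] W) {q' : W → ℝ}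
    (h : HasNegIndex q k) (hq : ∀ x, q' (e x) = q x) : HasNegIndex q' k := by
  obtain ⟨N, P, hk, hd, hN, hP⟩ := h
  refine ⟨N.map (e : V →ₗ[ℂ] W), P.map (e : V →ₗ[ℂ] W), ?_, ?_, ?_, ?_⟩
  · rw [LinearEquiv.finrank_map_eq, hk]
  · rw [LinearEquiv.finrank_map_eq, LinearEquiv.finrank_map_eq, hd, e.finrank_eq]
  · rintro _ ⟨x, hx, rfl⟩ h0
    have hx0 : x ≠ 0 := by rintro rfl; simp at h0
    exact (hq x).trans_lt (hN x hx hx0)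
  · rintro _ ⟨x, hx, rfl⟩
    exact (hP x hx).trans_eq (hq x).symm

theorem finrank_submodule_prod [FiniteDimensional ℂ V] [FiniteDimensional ℂ W]
    (N : Submodule ℂ V) (N' : Submodule ℂ W) :
    Module.finrank ℂ (N.prod N') = Module.finrank ℂ N + Module.finrank ℂ N' := by
  have h : LinearMap.range (N.subtype.prodMap N'.subtype) = N.prod N' := by
    rw [LinearMap.range_prodMap, Submodule.range_subtype, Submodule.range_subtype]
  rw [← h, LinearMap.finrank_range_of_inj, Module.finrank_prod]
  exact Function.Injective.prodMap N.subtype_injective N'.subtype_injective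

theorem HasNegIndex.prod [FiniteDimensional ℂ V] [FiniteDimensional ℂ W]
    {q : V → ℝ} {q' : W → ℝ} {k l : ℕ} (h : HasNegIndex q k) (h' : HasNegIndex q' l)
    (h0 : q 0 = 0) (h0' : q' 0 = 0) :
    HasNegIndex (fun x : V × W => q x.1 + q' x.2) (k + l) := by
  obtain ⟨N, P, rfl, hd, hN, hP⟩ := h
  obtain ⟨N', P', rfl, hd', hN', hP'⟩ := h'
  refine ⟨N.prod N', P.prod P', finrank_submodule_prod N N', ?_, ?_, ?_⟩
  · rw [finrank_submodule_prod, finrank_submodule_prod, Module.finrank_prod]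
    omega
  · rintro ⟨x, y⟩ ⟨hx, hy⟩ hxy
    change q x + q' y < 0
    rcases eq_or_ne x 0 with rfl | hx0
    · have hy0 : y ≠ 0 := by rintro rfl; exact hxy rfl
      linarith [hN' y hy hy0]
    · rcases eq_or_ne y 0 with rfl | hy0
      · linarith [hN x hx hx0]
      · linarith [hN' y hy hy0, hN x hx hx0]
  · rintro ⟨x, y⟩ ⟨hx, hy⟩
    exact add_nonneg (hP x hx) (hP' y hy)

end NegIndex

/-! ### Negative index of self-adjoint operators and its perturbation. -/

section Symmetric

variable {V : Type*} [NormedAddCommGroup V] [InnerProductSpace ℂ V] [FiniteDimensional ℂ V]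

/-- The negative index of the form `⟨x, T x⟩`. -/
noncomputable def opNegIndex (T : V →ₗ[ℂ] V) : ℕ := negIndex fun x y => inner ℂ x (T y)

open Classical in
theorem finrank_span_subfamily {V : Type*} [AddCommGroup V] [Module ℂ V] {ι : Type*} [Fintype ι] {b : ι → V} (hb : LinearIndependent ℂ b)
    (p : ι → Prop) :
    Module.finrank ℂ (Submodule.span ℂ (Set.range fun i : {i // p i} => b i))
      = (Finset.univ.filter p).card := by
  rw [← Fintype.card_subtype]
  exact finrank_span_eq_card (hb.comp (fun i : {i // p i} => (i : ι)) Subtype.val_injective)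

/-- `N`, `NZ`, `P`, `PZ` are spanned by the eigenvectors with negative, nonpositive, positive and
nonnegative eigenvalues. The spectral gap `δ` around `0` is what leaves room for perturbations. -/
theorem exists_spectral_splitting {T : V →ₗ[ℂ] V} (hT : T.IsSymmetric) :
    ∃ (N NZ P PZ : Submodule ℂ V) (δ : ℝ), 0 < δ ∧
      Module.finrank ℂ N + Module.finrank ℂ PZ = Module.finrank ℂ V ∧
      Module.finrank ℂ NZ + Module.finrank ℂ P = Module.finrank ℂ V ∧
      Module.finrank ℂ NZ = Module.finrank ℂ N + Module.finrank ℂ (LinearMap.ker T) ∧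
      (∀ x ∈ N, (inner ℂ x (T x)).re ≤ -(δ * ‖x‖ ^ 2)) ∧
      (∀ x ∈ P, δ * ‖x‖ ^ 2 ≤ (inner ℂ x (T x)).re) ∧
      (∀ x ∈ NZ, (inner ℂ x (T x)).re ≤ 0) ∧ (∀ x ∈ PZ, 0 ≤ (inner ℂ x (T x)).re) := by
  classical
  obtain ⟨b, l, hTb⟩ : ∃ (b : OrthonormalBasis (Fin (Module.finrank ℂ V)) ℂ V)
      (l : Fin (Module.finrank ℂ V) → ℝ), ∀ i, T (b i) = (l i : ℂ) • b i :=
    ⟨hT.eigenvectorBasis rfl, hT.eigenvalues rfl, hT.apply_eigenvectorBasis rfl⟩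
  have hTx : ∀ i x, inner ℂ (b i) (T x) = (l i : ℂ) * inner ℂ (b i) x := by
    intro i x
    rw [← hT, hTb, inner_smul_left, Complex.conj_ofReal]
  have hq : ∀ x, (inner ℂ x (T x)).re = ∑ i, l i * ‖inner ℂ (b i) x‖ ^ 2 := by
    intro x
    rw [← b.sum_inner_mul_inner x (T x), Complex.re_sum]
    refine Finset.sum_congr rfl fun i _ => ?_
    rw [hTx, ← inner_conj_symm x (b i), mul_left_comm, Complex.conj_mul', Complex.re_ofReal_mul]
    norm_cast
  have hnorm : ∀ x, ‖x‖ ^ 2 = ∑ i, ‖inner ℂ (b i) x‖ ^ 2 := fun x =>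
    (b.sum_sq_norm_inner_right x).symm
  -- There may be no nonzero eigenvalue, so `δ` is taken sufficiently small rather than as a
  -- minimum.
  obtain ⟨δ, hδ0, hδ⟩ : ∃ δ : ℝ, 0 < δ ∧ ∀ i, l i ≠ 0 → δ ≤ |l i| := by
    have h1 : ∀ᶠ δ in 𝓝[>] (0 : ℝ), ∀ i, l i ≠ 0 → δ ≤ |l i| := by
      rw [eventually_all]
      intro i
      by_cases hi : l i = 0
      · simp [hi]
      · filter_upwards [Ioo_mem_nhdsGT (abs_pos.2 hi)] with δ hδ _ using hδ.2.le
    obtain ⟨δ, h2, h3⟩ := (h1.and self_mem_nhdsWithin).exists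
    exact ⟨δ, h3, h2⟩
  -- `E p` is the span of the eigenvectors whose index satisfies `p`.
  obtain ⟨E, hE, hbE, hEle⟩ : ∃ E : (Fin (Module.finrank ℂ V) → Prop) → Submodule ℂ V,
      (∀ p, Module.finrank ℂ (E p) = (Finset.univ.filter p).card) ∧
      (∀ p i, p i → b i ∈ E p) ∧
      ∀ p (F : Submodule ℂ V), (∀ i, p i → b i ∈ F) → E p ≤ F :=
    ⟨_, finrank_span_subfamily b.orthonormal.linearIndependent,
      fun p i hi => Submodule.subset_span ⟨⟨i, hi⟩, rfl⟩, fun p F hF =>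
      Submodule.span_le.2 (by rintro _ ⟨i, rfl⟩; exact hF i i.2)⟩
  have hc : ∀ p, ∀ x ∈ E p, ∀ j, ¬ p j → inner ℂ (b j) x = 0 := by
    intro p x hx j hj
    have h1 : E p ≤ LinearMap.ker (innerₛₗ ℂ (b j)) := by
      refine hEle p _ fun i hi => ?_
      have hne : j ≠ i := by rintro rfl; exact hj hi
      simpa using b.orthonormal.2 hne
    simpa using h1 hx
  have hker : LinearMap.ker T = E fun i => l i = 0 := by
    apply le_antisymm
    · intro x hx
      rw [← b.sum_repr' x]
      refine Submodule.sum_mem _ fun i _ => ?_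
      by_cases hi : l i = 0
      · exact Submodule.smul_mem _ _ (hbE _ i hi)
      · have h1 := hTx i x
        rw [LinearMap.mem_ker.1 hx, inner_zero_right] at h1
        have h2 : inner ℂ (b i) x = 0 :=
          (mul_eq_zero.1 h1.symm).resolve_left (by exact_mod_cast hi)
        rw [h2, zero_smul]
        exact Submodule.zero_mem _
    · refine hEle _ _ fun i hi => ?_
      rw [LinearMap.mem_ker, hTb, hi, Complex.ofReal_zero, zero_smul]
  have hcard : ∀ p : Fin (Module.finrank ℂ V) → Prop,
      Module.finrank ℂ (E p) + Module.finrank ℂ (E fun i => ¬ p i) = Module.finrank ℂ V := by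
    intro p
    have h := Finset.card_filter_add_card_filter_not
      (s := (Finset.univ : Finset (Fin (Module.finrank ℂ V)))) p
    rw [Finset.card_univ, Fintype.card_fin] at h
    rw [hE, hE]
    refine Eq.trans ?_ h
    congr
  refine ⟨E fun i => l i < 0, E fun i => ¬ 0 < l i, E fun i => 0 < l i, E fun i => ¬ l i < 0,
    δ, hδ0, ?_, ?_, ?_, ?_, ?_, ?_, ?_⟩
  · rw [hcard]
  · rw [add_comm, hcard]
  · rw [hker, hE, hE, hE, ← Finset.card_union_of_disjoint]
    · congr 1
      ext i
      simp [le_iff_lt_or_eq]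
    · rw [Finset.disjoint_filter]
      intro i _ h1 h2
      exact h1.ne h2
  · intro x hx
    rw [hq, hnorm, Finset.mul_sum, ← Finset.sum_neg_distrib]
    refine Finset.sum_le_sum fun i _ => ?_
    by_cases hi : l i < 0
    · have h1 := hδ i hi.ne
      rw [abs_of_neg hi] at h1
      nlinarith [sq_nonneg ‖inner ℂ (b i) x‖]
    · simp [hc _ x hx i hi]
  · intro x hx
    rw [hq, hnorm, Finset.mul_sum]
    refine Finset.sum_le_sum fun i _ => ?_
    by_cases hi : 0 < l i
    · have h1 := hδ i hi.ne'
      rw [abs_of_pos hi] at h1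
      gcongr
    · simp [hc _ x hx i hi]
  · intro x hx
    rw [hq]
    refine Finset.sum_nonpos fun i _ => ?_
    by_cases hi : 0 < l i
    · simp [hc _ x hx i (not_not.2 hi)]
    · exact mul_nonpos_of_nonpos_of_nonneg (not_lt.1 hi) (sq_nonneg _)
  · intro x hx
    rw [hq]
    refine Finset.sum_nonneg fun i _ => ?_
    by_cases hi : l i < 0
    · simp [hc _ x hx i (not_not.2 hi)]
    · exact mul_nonneg (not_lt.1 hi) (sq_nonneg _)

theorem hasNegIndex_opNegIndex {T : V →ₗ[ℂ] V} (hT : T.IsSymmetric) :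
    HasNegIndex (fun x => (inner ℂ x (T x)).re) (opNegIndex T) := by
  obtain ⟨N, NZ, P, PZ, δ, hδ, h1, h2, h3, hN, hP, hNZ, hPZ⟩ :=
    exists_spectral_splitting hT
  have h : HasNegIndex (fun x => (inner ℂ x (T x)).re) (Module.finrank ℂ N) := by
    refine ⟨N, PZ, rfl, h1, fun x hx hx0 => (hN x hx).trans_lt ?_, hPZ⟩
    have := norm_pos_iff.2 hx0
    have : 0 < δ * ‖x‖ ^ 2 := by positivity
    linarith
  rw [opNegIndex, h.negIndex_eq (Q := fun x y => inner ℂ x (T y))]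
  exact h

theorem opNegIndex_neg {T : V →ₗ[ℂ] V} (hT : T.IsSymmetric) :
    opNegIndex T + opNegIndex (-T) + Module.finrank ℂ (LinearMap.ker T)
      = Module.finrank ℂ V := by
  obtain ⟨N, NZ, P, PZ, δ, hδ, h1, h2, h3, hN, hP, hNZ, hPZ⟩ :=
    exists_spectral_splitting hT
  have hpos : ∀ x : V, x ≠ 0 → 0 < δ * ‖x‖ ^ 2 := by
    intro x hx
    have := norm_pos_iff.2 hx
    positivity
  have h : HasNegIndex (fun x => (inner ℂ x (T x)).re) (Module.finrank ℂ N) :=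
    ⟨N, PZ, rfl, h1, fun x hx hx0 => by linarith [hN x hx, hpos x hx0], hPZ⟩
  have h' : HasNegIndex (fun x => (inner ℂ x ((-T) x)).re) (Module.finrank ℂ P) := by
    refine ⟨P, NZ, rfl, by omega, fun x hx hx0 => ?_, fun x hx => ?_⟩
    · simp only [LinearMap.neg_apply, inner_neg_right, Complex.neg_re]
      linarith [hP x hx, hpos x hx0]
    · simp only [LinearMap.neg_apply, inner_neg_right, Complex.neg_re]
      linarith [hNZ x hx]
  have e1 : opNegIndex T = _ := h.negIndex_eq (Q := fun x y => inner ℂ x (T y))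
  have e2 : opNegIndex (-T) = _ := h'.negIndex_eq (Q := fun x y => inner ℂ x ((-T) y))
  omega

/-- A small positive perturbation does not change the negative index; a small negative one adds
the nullity. -/
theorem exists_opNegIndex_perturbation {T : V →ₗ[ℂ] V} (hT : T.IsSymmetric) :
    ∃ δ > 0, ∀ C : V →ₗ[ℂ] V,
      (∀ x, x ≠ 0 → 0 < (inner ℂ x (C x)).re ∧ (inner ℂ x (C x)).re < δ * ‖x‖ ^ 2) →
      opNegIndex (T + C) = opNegIndex T ∧
        opNegIndex (T - C) = opNegIndex T + Module.finrank ℂ (LinearMap.ker T) := by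
  obtain ⟨N, NZ, P, PZ, δ, hδ, h1, h2, h3, hN, hP, hNZ, hPZ⟩ :=
    exists_spectral_splitting hT
  refine ⟨δ, hδ, fun C hC => ?_⟩
  have hC0 : ∀ x, 0 ≤ (inner ℂ x (C x)).re ∧ (inner ℂ x (C x)).re ≤ δ * ‖x‖ ^ 2 := by
    intro x
    rcases eq_or_ne x 0 with rfl | hx
    · simp
    · exact ⟨(hC x hx).1.le, (hC x hx).2.le⟩
  have h : HasNegIndex (fun x => (inner ℂ x (T x)).re) (Module.finrank ℂ N) := by
    refine ⟨N, PZ, rfl, h1, fun x hx hx0 => ?_, hPZ⟩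
    linarith [hN x hx, hC x hx0]
  -- On `N` the gap `δ` outweighs `C`; on `PZ` adding `C` preserves nonnegativity.
  have ha : HasNegIndex (fun x => (inner ℂ x ((T + C) x)).re) (Module.finrank ℂ N) := by
    refine ⟨N, PZ, rfl, h1, fun x hx hx0 => ?_, fun x hx => ?_⟩
    · simp only [LinearMap.add_apply, inner_add_right, Complex.add_re]
      linarith [hN x hx, hC x hx0]
    · simp only [LinearMap.add_apply, inner_add_right, Complex.add_re]
      linarith [hPZ x hx, hC0 x]
  -- Subtracting `C` makes the kernel directions negative, so `NZ` replaces `N`; on `P` the gap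
  -- absorbs `C`.
  have hs : HasNegIndex (fun x => (inner ℂ x ((T - C) x)).re) (Module.finrank ℂ NZ) := by
    refine ⟨NZ, P, rfl, h2, fun x hx hx0 => ?_, fun x hx => ?_⟩
    · simp only [LinearMap.sub_apply, inner_sub_right, Complex.sub_re]
      linarith [hNZ x hx, hC x hx0]
    · simp only [LinearMap.sub_apply, inner_sub_right, Complex.sub_re]
      linarith [hP x hx, hC0 x]
  have e0 : opNegIndex T = _ := h.negIndex_eq (Q := fun x y => inner ℂ x (T y))
  have e1 : opNegIndex (T + C) = _ := ha.negIndex_eq (Q := fun x y => inner ℂ x ((T + C) y))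
  have e2 : opNegIndex (T - C) = _ := hs.negIndex_eq (Q := fun x y => inner ℂ x ((T - C) y))
  omega

end Symmetric

end Duistermaat

namespace Duistermaat

/-! ### Lagrangian planes as self-adjoint operators; independence of the auxiliary plane. -/

section Symplectic

variable {K : Type*} [NormedAddCommGroup K] [InnerProductSpace ℂ K]

theorem omega_add_left (u v w : Phase K) : omega (u + v) w = omega u w + omega v w := by
  simp only [omega_eq_inner, inner_add_left]

theorem omega_add_right (u v w : Phase K) : omega u (v + w) = omega u v + omega u w := by
  simp only [omega_eq_inner, map_add, inner_add_right]

theorem omega_sub_right (u v w : Phase K) : omega u (v - w) = omega u v - omega u w := by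
  simp only [omega_eq_inner, map_sub, inner_sub_right]

theorem conj_omega (u v : Phase K) : starRingEnd ℂ (omega u v) = -omega v u := by
  simp only [omega, map_sub, inner_conj_symm, neg_sub]

theorem omega_eq_zero_of_mem_sup {L M : Lagr K} {x : Phase K} (hL : x ∈ L.plane)
    (hM : x ∈ M.plane) {y : Phase K} (hy : y ∈ L.plane ⊔ M.plane) : omega x y = 0 := by
  obtain ⟨a, ha, b, hb, rfl⟩ := Submodule.mem_sup.1 hy
  rw [omega_add_right, L.omega_eq_zero hL ha, M.omega_eq_zero hM hb, add_zero]

theorem eq_zero_of_forall_omega {x : Phase K} (h : ∀ y, omega x y = 0) : x = 0 := by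
  have h1 : omega x (J x) = -inner ℂ x x := by
    rw [WithLp.prod_inner_apply]
    simp [omega, J]
    ring
  rw [h, zero_eq_neg] at h1
  exact inner_self_eq_zero.1 h1

theorem transversal_of_codisjoint {L M : Lagr K} (h : Codisjoint L.plane M.plane) :
    Transversal L M := by
  rw [Transversal, Submodule.eq_bot_iff]
  rintro x ⟨hL, hM⟩
  refine eq_zero_of_forall_omega fun y => omega_eq_zero_of_mem_sup hL hM ?_
  rw [codisjoint_iff.1 h]
  trivial

theorem Transversal.eq_zero {L M : Lagr K} (h : Transversal L M) {x : Phase K}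
    (hL : x ∈ L.plane) (hM : x ∈ M.plane) : x = 0 := by
  have : x ∈ L.plane ⊓ M.plane := ⟨hL, hM⟩
  rw [h] at this
  exact (Submodule.mem_bot ℂ).1 this

variable [FiniteDimensional ℂ K] {B M L L' L₁ L₂ L₃ : Lagr K}

theorem add_graphMap_mem (hB : Transversal M B) (h : Transversal M L) (u : B.plane) :
    (u : Phase K) + graphMap B.plane M.plane L.plane h.isCompl u ∈ L.plane :=
  (mem_iff_graphMap h.isCompl hB.isCompl.symm _).2 ⟨u, rfl⟩

theorem graphMap_eq_of_add_mem (hB : Transversal M B) (h : Transversal M L) (u : B.plane)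
    (b : M.plane) (hb : (u : Phase K) + b ∈ L.plane) :
    graphMap B.plane M.plane L.plane h.isCompl u = b := by
  rw [← sub_eq_zero]
  apply Subtype.ext
  refine h.eq_zero (Subtype.mem _) ?_
  have := L.plane.sub_mem (add_graphMap_mem hB h u) hb
  rw [add_sub_add_left_eq_sub] at this
  exact this

/-- The operator on `B` that represents a plane `L` transversal to `M`, where `B` is also
transversal to `M`: if `L` is the graph of `A : B → M`, then `⟨u, T v⟩ = ω(u, A v)`. -/
noncomputable def chartOp (B : Lagr K) (h : Transversal M L) : B.plane →ₗ[ℂ] B.plane :=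
  (B.plane.orthogonalProjectionOnto : Phase K →ₗ[ℂ] B.plane) ∘ₗ J ∘ₗ M.plane.subtype ∘ₗ
    graphMap B.plane M.plane L.plane h.isCompl

theorem inner_chartOp (h : Transversal M L) (u v : B.plane) :
    inner ℂ u (chartOp B h v)
      = omega (u : Phase K) (graphMap B.plane M.plane L.plane h.isCompl v : Phase K) := by
  rw [omega_eq_inner]
  exact Submodule.inner_orthogonalProjectionOnto_eq_of_mem_left _ _

/-- The linear equivalence of `B` with `L` along `M`. -/
noncomputable def chartEquiv (hB : Transversal M B) (h : Transversal M L) :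
    B.plane ≃ₗ[ℂ] L.plane :=
  LinearEquiv.ofBijective
    (LinearMap.codRestrict L.plane
      (B.plane.subtype + M.plane.subtype ∘ₗ graphMap B.plane M.plane L.plane h.isCompl)
      (add_graphMap_mem hB h))
    (by
      constructor
      · rw [← LinearMap.ker_eq_bot, LinearMap.ker_eq_bot']
        intro u hu
        replace hu := congrArg Subtype.val hu
        apply Subtype.ext
        refine hB.eq_zero ?_ u.2
        have hu' : (u : Phase K) = -(graphMap B.plane M.plane L.plane h.isCompl u : Phase K) :=
          eq_neg_of_add_eq_zero_left hu
        rw [hu']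
        exact M.plane.neg_mem (Subtype.mem _)
      · rintro ⟨x, hx⟩
        obtain ⟨u, hu⟩ := (mem_iff_graphMap h.isCompl hB.isCompl.symm x).1 hx
        exact ⟨u, Subtype.ext hu.symm⟩)

theorem coe_chartEquiv (hB : Transversal M B) (h : Transversal M L) (u : B.plane) :
    (chartEquiv hB h u : Phase K)
      = u + (graphMap B.plane M.plane L.plane h.isCompl u : Phase K) := rfl

/-- Let `L`, `L'` be the graphs of `A`, `A'`. As `B` and `M` are isotropic, only `ω(u, A' v) + ω(A
u, v)` survives, and isotropy of `L` turns the second term into `-ω(u, A v)`. -/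
theorem omega_chartEquiv (hB : Transversal M B) (h : Transversal M L) (h' : Transversal M L')
    (u v : B.plane) :
    omega (chartEquiv hB h u : Phase K) (chartEquiv hB h' v : Phase K)
      = inner ℂ u ((chartOp B h' - chartOp B h) v) := by
  have h1 := L.omega_eq_zero (chartEquiv hB h u).2 (chartEquiv hB h v).2
  simp only [coe_chartEquiv, omega_add_left, omega_add_right, B.omega_eq_zero u.2 v.2,
    M.omega_eq_zero (Subtype.mem _) (Subtype.mem _), zero_add, add_zero] at h1 ⊢
  rw [LinearMap.sub_apply, inner_sub_right, inner_chartOp, inner_chartOp]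
  linear_combination h1

theorem chartOp_isSymmetric (hB : Transversal M B) (h : Transversal M L) :
    (chartOp B h).IsSymmetric := by
  intro u v
  have h1 := L.omega_eq_zero (chartEquiv hB h u).2 (chartEquiv hB h v).2
  simp only [coe_chartEquiv, omega_add_left, omega_add_right, B.omega_eq_zero u.2 v.2,
    M.omega_eq_zero (Subtype.mem _) (Subtype.mem _), zero_add, add_zero] at h1
  rw [← inner_conj_symm, inner_chartOp, inner_chartOp, conj_omega]
  linear_combination -h1

/-- Passing from `u + A u` in `L` to `u + A' u` in `L'` adds `(A' - A) u`, which lies in `M`; this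
identifies the graph map over `L`. -/
theorem formQ_chartEquiv (hB : Transversal M B) (h : Transversal M L) (h' : Transversal M L')
    (u v : B.plane) :
    formQ L.plane M.plane L'.plane h'.isCompl (chartEquiv hB h u) (chartEquiv hB h v)
      = inner ℂ u ((chartOp B h' - chartOp B h) v) := by
  have h1 : graphMap L.plane M.plane L'.plane h'.isCompl (chartEquiv hB h v)
      = graphMap B.plane M.plane L'.plane h'.isCompl v
        - graphMap B.plane M.plane L.plane h.isCompl v := by
    refine graphMap_eq_of_add_mem h h' _ _ ?_
    rw [coe_chartEquiv, Submodule.coe_sub, add_add_sub_cancel]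
    exact add_graphMap_mem hB h' v
  rw [formQ, h1, coe_chartEquiv, omega_add_left, M.omega_eq_zero (Subtype.mem _) (Subtype.mem _),
    add_zero, Submodule.coe_sub, omega_sub_right, LinearMap.sub_apply, inner_sub_right,
    inner_chartOp, inner_chartOp]

theorem negIndex_formQ (hB : Transversal M B) (h : Transversal M L) (h' : Transversal M L') :
    negIndex (formQ L.plane M.plane L'.plane h'.isCompl)
      = opNegIndex (chartOp B h' - chartOp B h) := by
  refine HasNegIndex.negIndex_eq (HasNegIndex.of_equiv (chartEquiv hB h)
    (hasNegIndex_opNegIndex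
      ((chartOp_isSymmetric hB h').sub (chartOp_isSymmetric hB h))) fun u => ?_)
  rw [formQ_chartEquiv hB h h']

/-- A vector of `L` lies in `L'` exactly when it is `ω`-orthogonal to `L'`, and by
`omega_chartEquiv` this pairing is given by the difference of the operators. -/
theorem dimInter_eq_finrank_ker (hB : Transversal M B) (h : Transversal M L)
    (h' : Transversal M L') :
    dimInter L L' = Module.finrank ℂ (LinearMap.ker (chartOp B h' - chartOp B h)) := by
  have hmap : (LinearMap.ker (chartOp B h' - chartOp B h)).map
      (L.plane.subtype ∘ₗ (chartEquiv hB h : B.plane →ₗ[ℂ] L.plane)) = L.plane ⊓ L'.plane := by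
    ext x
    constructor
    · rintro ⟨u, hu, rfl⟩
      refine ⟨(chartEquiv hB h u).2, ?_⟩
      change (chartEquiv hB h u : Phase K) ∈ L'.plane
      rw [← L'.isLagrangian, mem_sympCompl]
      intro v hv
      obtain ⟨w, hw⟩ := (chartEquiv hB h').surjective ⟨v, hv⟩
      have h1 := omega_chartEquiv hB h h' u w
      rw [hw] at h1
      rw [h1, ← ((chartOp_isSymmetric hB h').sub (chartOp_isSymmetric hB h)) u w,
        LinearMap.mem_ker.1 hu, inner_zero_left]
    · rintro ⟨hx, hx'⟩
      obtain ⟨u, hu⟩ := (chartEquiv hB h).surjective ⟨x, hx⟩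
      have hux : (chartEquiv hB h u : Phase K) = x := by rw [hu]
      refine ⟨u, ?_, hux⟩
      change (chartOp B h' - chartOp B h) u = 0
      rw [← inner_self_eq_zero (𝕜 := ℂ),
        ((chartOp_isSymmetric hB h').sub (chartOp_isSymmetric hB h)) u,
        ← omega_chartEquiv hB h h', hux]
      exact L'.omega_eq_zero hx' (Subtype.mem _)
  have hinj : Function.Injective
      (L.plane.subtype ∘ₗ (chartEquiv hB h : B.plane →ₗ[ℂ] L.plane)) :=
    L.plane.subtype_injective.comp (chartEquiv hB h).injective
  rw [dimInter, ← hmap, (Submodule.equivMapOfInjective _ hinj _).finrank_eq]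

theorem indexVia_eq_opNegIndex (hB : Transversal M B) (h₁ : Transversal M L₁)
    (h₂ : Transversal M L₂) (h₃ : Transversal M L₃) :
    indexVia L₁ L₂ L₃ M h₂ h₃ = (opNegIndex (chartOp B h₃ - chartOp B h₂) : ℤ)
      - opNegIndex (chartOp B h₃ - chartOp B h₁) + opNegIndex (chartOp B h₂ - chartOp B h₁) := by
  rw [indexVia, negIndex_formQ hB h₂ h₃, negIndex_formQ hB h₁ h₃, negIndex_formQ hB h₁ h₂]

/-- The Kashiwara form `Re (ω(x₁, x₂) + ω(x₂, x₃) + ω(x₃, x₁))` on `L₁ ⊕ L₂ ⊕ L₃`. -/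
noncomputable def kashiwara (L₁ L₂ L₃ : Lagr K) (x : (L₁.plane × L₂.plane) × L₃.plane) : ℝ :=
  (omega (x.1.1 : Phase K) x.1.2 + omega (x.1.2 : Phase K) x.2
    + omega (x.2 : Phase K) x.1.1).re

/-- The automorphism `(x, y, z) ↦ (x + z, x + y, y + z)`. -/
noncomputable def cyclicSum (V : Type*) [AddCommGroup V] [Module ℂ V] [FiniteDimensional ℂ V] :
    ((V × V) × V) ≃ₗ[ℂ] (V × V) × V :=
  LinearEquiv.ofInjectiveEndo
    { toFun := fun z => ((z.1.1 + z.2, z.1.1 + z.1.2), z.1.2 + z.2)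
      map_add' := by
        intro a b
        ext <;> simp <;> abel
      map_smul' := by
        intro c a
        ext <;> simp }
    (by
      rw [← LinearMap.ker_eq_bot, LinearMap.ker_eq_bot']
      rintro ⟨⟨x, y⟩, z⟩ h
      simp only [LinearMap.coe_mk, AddHom.coe_mk, Prod.mk_eq_zero] at h
      obtain ⟨⟨h1, h2⟩, h3⟩ := h
      have hx : (2 : ℂ) • x = 0 := by
        rw [two_smul]
        calc x + x = (x + z) + (x + y) - (y + z) := by abel
          _ = 0 := by rw [h1, h2, h3]; simp
      have hx0 : x = 0 := (smul_eq_zero.1 hx).resolve_left two_ne_zero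
      subst hx0
      rw [zero_add] at h1 h2
      simp [h1, h2])

/-- In the chart, the substitution `cyclicSum` cancels all cross terms and leaves `⟨x, (T₂ - T₁) x⟩
+ ⟨y, (T₃ - T₂) y⟩ + ⟨z, (T₁ - T₃) z⟩`. -/
theorem hasNegIndex_kashiwara (hB : Transversal M B) (h₁ : Transversal M L₁)
    (h₂ : Transversal M L₂) (h₃ : Transversal M L₃) :
    HasNegIndex (kashiwara L₁ L₂ L₃) (opNegIndex (chartOp B h₂ - chartOp B h₁)
      + opNegIndex (chartOp B h₃ - chartOp B h₂) + opNegIndex (chartOp B h₁ - chartOp B h₃)) := by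
  have s₁ := chartOp_isSymmetric hB h₁
  have s₂ := chartOp_isSymmetric hB h₂
  have s₃ := chartOp_isSymmetric hB h₃
  have hsum := ((hasNegIndex_opNegIndex (s₂.sub s₁)).prod (hasNegIndex_opNegIndex (s₃.sub s₂))
    (by simp) (by simp)).prod (hasNegIndex_opNegIndex (s₁.sub s₃)) (by simp) (by simp)
  refine hsum.of_equiv ((cyclicSum B.plane).trans
    (((chartEquiv hB h₁).prodCongr (chartEquiv hB h₂)).prodCongr (chartEquiv hB h₃))) ?_
  rintro ⟨⟨x, y⟩, z⟩
  have hsymm : ∀ {T : B.plane →ₗ[ℂ] B.plane}, T.IsSymmetric → ∀ u v : B.plane,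
      (inner ℂ u (T v)).re = (inner ℂ v (T u)).re := by
    intro T hT u v
    rw [← hT u v, ← inner_conj_symm, Complex.conj_re]
  change (omega (chartEquiv hB h₁ (x + z) : Phase K) (chartEquiv hB h₂ (x + y) : Phase K)
    + omega (chartEquiv hB h₂ (x + y) : Phase K) (chartEquiv hB h₃ (y + z) : Phase K)
    + omega (chartEquiv hB h₃ (y + z) : Phase K) (chartEquiv hB h₁ (x + z) : Phase K)).re = _
  rw [omega_chartEquiv, omega_chartEquiv, omega_chartEquiv]
  simp only [LinearMap.sub_apply, map_add, inner_add_left, inner_add_right, inner_sub_right,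
    Complex.add_re, Complex.sub_re]
  linarith [hsymm s₁ x y, hsymm s₁ x z, hsymm s₁ y z, hsymm s₂ x y, hsymm s₂ x z, hsymm s₂ y z,
    hsymm s₃ x y, hsymm s₃ x z, hsymm s₃ y z]

/-- The index does not depend on the auxiliary plane. -/
theorem indexVia_eq_of_transversal {M' : Lagr K} (h₁ : Transversal M L₁) (h₂ : Transversal M L₂)
    (h₃ : Transversal M L₃) (h₁' : Transversal M' L₁) (h₂' : Transversal M' L₂)
    (h₃' : Transversal M' L₃) :
    indexVia L₁ L₂ L₃ M h₂ h₃ = indexVia L₁ L₂ L₃ M' h₂' h₃' := by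
  -- Both charts use the base `L₁`. The cyclic sum contains `n₋(T₁ - T₃)` where the index has
  -- `-n₋(T₃ - T₁)`; `opNegIndex_neg` exchanges them at the cost of `n - dim L₁ ∩ L₃`, which is the
  -- same in both charts.
  have hk := (hasNegIndex_kashiwara h₁ h₁ h₂ h₃).unique (hasNegIndex_kashiwara h₁' h₁' h₂' h₃')
  have hn := opNegIndex_neg ((chartOp_isSymmetric h₁ h₃).sub (chartOp_isSymmetric h₁ h₁))
  have hn' := opNegIndex_neg ((chartOp_isSymmetric h₁' h₃').sub (chartOp_isSymmetric h₁' h₁'))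
  have hd := dimInter_eq_finrank_ker h₁ h₁ h₃
  have hd' := dimInter_eq_finrank_ker h₁' h₁' h₃'
  rw [neg_sub] at hn hn'
  rw [indexVia_eq_opNegIndex h₁ h₁ h₂ h₃, indexVia_eq_opNegIndex h₁' h₁' h₂' h₃']
  omega

theorem iota_eq_opNegIndex (hB : Transversal M B) (h₁ : Transversal M L₁)
    (h₂ : Transversal M L₂) (h₃ : Transversal M L₃) :
    iota L₁ L₂ L₃ = (opNegIndex (chartOp B h₃ - chartOp B h₂) : ℤ)
      - opNegIndex (chartOp B h₃ - chartOp B h₁) + opNegIndex (chartOp B h₂ - chartOp B h₁) := by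
  rw [iota, indexVia_eq_of_transversal (exists_transversal L₁ L₂ L₃).choose_spec.1
    (exists_transversal L₁ L₂ L₃).choose_spec.2.1 (exists_transversal L₁ L₂ L₃).choose_spec.2.2
    h₁ h₂ h₃, indexVia_eq_opNegIndex hB h₁ h₂ h₃]

theorem chartOp_self (h : Transversal M B) : chartOp B h = 0 := by
  ext1 u
  have h1 : graphMap B.plane M.plane B.plane h.isCompl u = 0 :=
    graphMap_eq_of_add_mem h h u 0 (by simp)
  simp [chartOp, h1]

theorem exists_transversal_four (L₁ L₂ L₃ L₄ : Lagr K) :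
    ∃ M : Lagr K, Transversal M L₁ ∧ Transversal M L₂ ∧ Transversal M L₃ ∧ Transversal M L₄ := by
  obtain ⟨s, hs⟩ := ((((finite_not_transversal L₁).union (finite_not_transversal L₂)).union
    (finite_not_transversal L₃)).union (finite_not_transversal L₄)).infinite_compl.nonempty
  simp only [Set.mem_compl_iff, Set.mem_union, Set.mem_ofPred_eq, not_or, not_not] at hs
  exact ⟨slopePlane K s, hs.1.1.1, hs.1.1.2, hs.1.2, hs.2⟩

end Symplectic

end Duistermaat

/-! ### Regularity and monotonicity of paths in a chart. -/

namespace Duistermaat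

/-- Here `J (A x)` lies in `L`, so isotropy gives `0 = ω(A x, J (A x)) = -‖A x‖²`. -/
theorem graphChart_eq_self {K : Type*} [NormedAddCommGroup K] [InnerProductSpace ℂ K]
    {L : Lagr K} {A : L.plane →L[ℂ] L.plane}
    (h : L.plane = graphChart L.plane A) : A = 0 := by
  ext1 x
  have hx : (x : Phase K) + J (A x : Phase K) ∈ L.plane := h.ge ⟨x, rfl⟩
  have hJ : J (A x : Phase K) ∈ L.plane := by simpa using L.plane.sub_mem hx x.2
  have h1 := L.omega_eq_zero (A x).2 hJ
  have h2 : ∀ y : Phase K, omega y (J y) = -inner ℂ y y := by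
    intro y
    rw [WithLp.prod_inner_apply]
    simp [omega, J]
    ring
  rw [h2, neg_eq_zero] at h1
  exact Subtype.ext (inner_self_eq_zero.1 h1)

theorem differentiableAt_comp_comp {E F G H : Type*} [NormedAddCommGroup E] [NormedSpace ℂ E]
    [NormedAddCommGroup F] [NormedSpace ℂ F] [NormedAddCommGroup G] [NormedSpace ℂ G]
    [NormedAddCommGroup H] [NormedSpace ℂ H] (S : G →L[ℂ] H) (R : E →L[ℂ] F)
    {A : ℝ → F →L[ℂ] G} {t : ℝ} (hA : DifferentiableAt ℝ A t) :
    DifferentiableAt ℝ (fun t => S.comp ((A t).comp R)) t := by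
  have h1 : DifferentiableAt ℝ (fun C : F →L[ℂ] G => S.comp (C.comp R)) (A t) :=
    (((ContinuousLinearMap.compL ℂ E G H S).comp
      ((ContinuousLinearMap.compL ℂ E F G).flip R)).restrictScalars ℝ).differentiableAt
  exact h1.comp (𝕜 := ℝ) t hA

section Paths

variable {K : Type*} [NormedAddCommGroup K] [InnerProductSpace ℂ K] [FiniteDimensional ℂ K]
variable {B M L : Lagr K}

open Classical in
/-- The projection onto `L` along `M`, if `L` and `M` are transversal (and `0` otherwise). -/
noncomputable def projAlong (M L : Lagr K) : Phase K →L[ℂ] Phase K :=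
  if h : Transversal M L then
    LinearMap.toContinuousLinearMap
      (L.plane.subtype ∘ₗ L.plane.projectionOnto M.plane h.isCompl.symm)
  else 0

theorem projAlong_mem (M L : Lagr K) (x : Phase K) : projAlong M L x ∈ L.plane := by
  unfold projAlong
  split_ifs with h
  · exact Subtype.mem _
  · exact L.plane.zero_mem

theorem sub_projAlong_mem (h : Transversal M L) (x : Phase K) :
    x - projAlong M L x ∈ M.plane := by
  rw [← Submodule.projectionOnto_apply_eq_zero_iff h.isCompl.symm, map_sub, sub_eq_zero]
  simp only [projAlong, dif_pos h]
  exact (Submodule.projectionOnto_apply_left h.isCompl.symm _).symm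

theorem projAlong_eq (h : Transversal M L) {x y : Phase K} (hy : y ∈ L.plane)
    (hxy : x - y ∈ M.plane) : projAlong M L x = y := by
  rw [← sub_eq_zero]
  refine h.eq_zero ?_ (L.plane.sub_mem (projAlong_mem M L x) hy)
  have := M.plane.sub_mem hxy (sub_projAlong_mem h x)
  rwa [sub_sub_sub_cancel_left] at this

theorem projAlong_eq_self (h : Transversal M L) {x : Phase K} (hx : x ∈ L.plane) :
    projAlong M L x = x :=
  projAlong_eq h hx (by simp)

theorem projAlong_eq_zero (h : Transversal M L) {x : Phase K} (hx : x ∈ M.plane) :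
    projAlong M L x = 0 :=
  projAlong_eq h L.plane.zero_mem (by simpa using hx)

theorem coe_graphMap (hB : Transversal M B) (h : Transversal M L) (u : B.plane) :
    (graphMap B.plane M.plane L.plane h.isCompl u : Phase K) = projAlong M L u - u := by
  have h1 : projAlong M L u = u + graphMap B.plane M.plane L.plane h.isCompl u :=
    projAlong_eq h (add_graphMap_mem hB h u) (by simp)
  rw [h1, add_sub_cancel_left]

theorem inner_chartOp_self (hB : Transversal M B) (h : Transversal M L) (u : B.plane) :
    inner ℂ u (chartOp B h u) = omega (u : Phase K) (projAlong M L u) := by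
  rw [inner_chartOp, coe_graphMap hB h, omega_sub_right, B.omega_eq_zero u.2 u.2, sub_zero]

/-- An automorphism that fixes `M` pointwise and maps `B` into `L` transports transversality to
`M`, and conjugates the projections along `M`. -/
theorem transversal_and_projAlong_eq (hB : Transversal M B) {X : Phase K →L[ℂ] Phase K}
    (hX : IsUnit X) (hXB : ∀ x ∈ B.plane, X x ∈ L.plane) (hXM : ∀ x ∈ M.plane, X x = x) :
    Transversal M L ∧ projAlong M L = X * projAlong M B * Ring.inverse X := by
  have hinv : ∀ x, X (Ring.inverse X x) = x := by
    intro x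
    have := Ring.mul_inverse_cancel X hX
    exact DFunLike.congr_fun this x
  have hdec : ∀ x, x - X (projAlong M B (Ring.inverse X x)) ∈ M.plane := by
    intro x
    have h1 := sub_projAlong_mem hB (Ring.inverse X x)
    have h2 := hXM _ h1
    rw [map_sub, hinv] at h2
    rw [h2]
    exact h1
  have hT : Transversal M L := by
    refine transversal_of_codisjoint (codisjoint_iff.2 (eq_top_iff.2 fun x _ => ?_))
    rw [← sub_add_cancel x (X (projAlong M B (Ring.inverse X x)))]
    exact Submodule.add_mem_sup (hdec x) (hXB _ (projAlong_mem _ _ _))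
  refine ⟨hT, ?_⟩
  ext1 x
  exact projAlong_eq hT (hXB _ (projAlong_mem _ _ _)) (hdec x)

/-- Operators near the identity are invertible, so regularity of the projections reduces to that of
`X` and of inversion in a Banach algebra. -/
theorem eventually_projAlong_eq {L : ℝ → Lagr K} {t₀ : ℝ} (h₀ : Transversal M (L t₀))
    {X : ℝ → Phase K →L[ℂ] Phase K} (hX : ContinuousAt X t₀) (hX₀ : X t₀ = 1)
    (hXL : ∀ᶠ t in 𝓝 t₀, ∀ x ∈ (L t₀).plane, X t x ∈ (L t).plane)
    (hXM : ∀ t, ∀ x ∈ M.plane, X t x = x) :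
    ∀ᶠ t in 𝓝 t₀, Transversal M (L t) ∧
      projAlong M (L t) = X t * projAlong M (L t₀) * Ring.inverse (X t) := by
  have hunit : ∀ᶠ t in 𝓝 t₀, IsUnit (X t) := by
    refine hX.eventually (Units.isOpen.mem_nhds ?_)
    rw [hX₀]
    exact isUnit_one
  filter_upwards [hunit, hXL] with t h1 h2
  exact transversal_and_projAlong_eq h₀ h1 h2 (hXM t)

theorem continuousAt_projAlong {L : ℝ → Lagr K} {t₀ : ℝ} (hL : ContinuousAt L t₀)
    (h₀ : Transversal M (L t₀)) :
    (∀ᶠ t in 𝓝 t₀, Transversal M (L t)) ∧ ContinuousAt (fun t => projAlong M (L t)) t₀ := by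
  have hP : ContinuousAt (fun t => (L t).plane.starProjection) t₀ :=
    (Isometry.of_dist_eq (f := fun L : Lagr K => L.plane.starProjection)
      fun _ _ => rfl).continuous.continuousAt.comp hL
  set E := projAlong M (L t₀) with hE
  -- `X t` projects the `L t₀`-component orthogonally to `L t` and keeps the `M`-component; gap
  -- continuity makes it continuous.
  set X : ℝ → Phase K →L[ℂ] Phase K := fun t => (L t).plane.starProjection * E + (1 - E) with hXdef
  have hX : ContinuousAt X t₀ := (hP.mul continuousAt_const).add continuousAt_const
  have hX₀ : X t₀ = 1 := by
    ext1 x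
    have : (L t₀).plane.starProjection (E x) = E x :=
      Submodule.starProjection_eq_self_iff.2 (projAlong_mem _ _ _)
    simp [hXdef, this]
  have hXL : ∀ᶠ t in 𝓝 t₀, ∀ x ∈ (L t₀).plane, X t x ∈ (L t).plane := by
    refine Eventually.of_forall fun t x hx => ?_
    have : E x = x := projAlong_eq_self h₀ hx
    simp [hXdef, this]
  have hXM : ∀ t, ∀ x ∈ M.plane, X t x = x := by
    intro t x hx
    have : E x = 0 := projAlong_eq_zero h₀ hx
    simp [hXdef, this]
  have key := eventually_projAlong_eq h₀ hX hX₀ hXL hXM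
  refine ⟨key.mono fun t ht => ht.1, ?_⟩
  have hinv : ContinuousAt Ring.inverse (X t₀) := by
    rw [hX₀]
    exact NormedRing.inverse_continuousAt 1
  exact ((hX.mul continuousAt_const).mul (ContinuousAt.comp hinv hX)).congr
    (key.mono fun t ht => ht.2.symm)

theorem differentiableAt_projAlong {L : ℝ → Lagr K} {t₀ : ℝ} (hL : PathDifferentiableAt L t₀)
    (h₀ : Transversal M (L t₀)) :
    (∀ᶠ t in 𝓝 t₀, Transversal M (L t)) ∧
      DifferentiableAt ℝ (fun t => projAlong M (L t)) t₀ := by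
  obtain ⟨A, hA, hAL⟩ := hL
  have hA₀ : A t₀ = 0 := graphChart_eq_self hAL.self_of_nhds.2
  set E₀ : Phase K →L[ℂ] (L t₀).plane := LinearMap.toContinuousLinearMap
    ((L t₀).plane.projectionOnto M.plane h₀.isCompl.symm) with hE₀
  have hE : ∀ x ∈ (L t₀).plane, (E₀ x : Phase K) = x := by
    intro x hx
    have := Submodule.projectionOnto_apply_left h₀.isCompl.symm ⟨x, hx⟩
    exact congrArg Subtype.val this
  have hEM : ∀ x ∈ M.plane, E₀ x = 0 := fun x hx =>
    (Submodule.projectionOnto_apply_eq_zero_iff h₀.isCompl.symm).2 hx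
  set Jc : Phase K →L[ℂ] Phase K := LinearMap.toContinuousLinearMap J with hJc
  -- On `L t₀` this is the graph parametrization `v ↦ v + J A(t) v`; on `M` it is the identity.
  set X : ℝ → Phase K →L[ℂ] Phase K := fun t =>
    1 + (Jc.comp (L t₀).plane.subtypeL).comp ((A t).comp E₀) with hXdef
  have hX : DifferentiableAt ℝ X t₀ := by
    have h1 := differentiableAt_comp_comp (Jc.comp (L t₀).plane.subtypeL) E₀ hA
    exact h1.const_add 1
  have hX₀ : X t₀ = 1 := by simp [hXdef, hA₀]
  have hXL : ∀ᶠ t in 𝓝 t₀, ∀ x ∈ (L t₀).plane, X t x ∈ (L t).plane := by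
    filter_upwards [hAL] with t ht x hx
    rw [ht.2]
    refine ⟨E₀ x, ?_⟩
    change (E₀ x : Phase K) + J (A t (E₀ x) : Phase K) = x + J (A t (E₀ x) : Phase K)
    rw [hE x hx]
  have hXM : ∀ t, ∀ x ∈ M.plane, X t x = x := by
    intro t x hx
    simp [hXdef, hEM x hx]
  have key := eventually_projAlong_eq h₀ hX.continuousAt hX₀ hXL hXM
  refine ⟨key.mono fun t ht => ht.1, ?_⟩
  have hinv : DifferentiableAt ℝ (Ring.inverse : (Phase K →L[ℂ] Phase K) → _) (X t₀) := by
    rw [hX₀]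
    exact (differentiableAt_inverse (𝕜 := ℂ) isUnit_one).restrictScalars ℝ
  exact ((hX.mul (differentiableAt_const _)).mul (hinv.comp t₀ hX)).congr_of_eventuallyEq
    (key.mono fun t ht => ht.2)

/-- In a chart, the derivative of the form that represents the path is the crossing form. -/
theorem hasDerivAt_omega_projAlong {L : ℝ → Lagr K} {t₀ : ℝ} (hL : PathDifferentiableAt L t₀)
    (h₀ : Transversal M (L t₀)) (u : Phase K) :
    HasDerivAt (fun t => (omega u (projAlong M (L t) u)).re)
      (crossingForm L t₀ (projAlong M (L t₀) u) (projAlong M (L t₀) u)).re t₀ := by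
  obtain ⟨hT, hd⟩ := differentiableAt_projAlong hL h₀
  have hw : DifferentiableAt ℝ (fun t => projAlong M (L t) u) t₀ := by
    have h1 : DifferentiableAt ℝ (fun C : Phase K →L[ℂ] Phase K => C u) (projAlong M (L t₀)) :=
      ((ContinuousLinearMap.apply ℂ (Phase K) u).restrictScalars ℝ).differentiableAt
    exact h1.comp (𝕜 := ℝ) t₀ hd
  have hsec : IsLocalSection L t₀ (fun t => projAlong M (L t) u) :=
    ⟨hw, Eventually.of_forall fun t => projAlong_mem _ _ _⟩
  rw [crossingForm_eq hL (projAlong_mem M (L t₀) u) hsec rfl]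
  have h1 := hasDerivAt_omega (hasDerivAt_const t₀ (projAlong M (L t₀) u)) hw.hasDerivAt
  -- Isotropy of `M` makes the pairing of `u - projAlong M (L t₀) u` with the moving section
  -- constant in `t`.
  have h2 : (fun t => omega u (projAlong M (L t) u)) =ᶠ[𝓝 t₀]
      fun t => omega (projAlong M (L t₀) u) (projAlong M (L t) u)
        + omega (u - projAlong M (L t₀) u) u := by
    filter_upwards [hT] with t ht
    have h3 := M.omega_eq_zero (sub_projAlong_mem h₀ u) (sub_projAlong_mem ht u)
    rw [omega_sub_right] at h3
    have h4 := omega_add_left (projAlong M (L t₀) u) (u - projAlong M (L t₀) u)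
      (projAlong M (L t) u)
    rw [add_sub_cancel] at h4
    rw [h4, sub_eq_zero.1 h3]
  have h5 := (h1.differentiableAt.hasDerivAt.add_const
    (omega (u - projAlong M (L t₀) u) u)).congr_of_eventuallyEq h2
  exact Complex.reCLM.hasFDerivAt.comp_hasDerivAt t₀ h5

/-- For fixed `u`, the value `⟨u, T(s) u⟩` is continuous, vanishes at `s = 0` and has positive
derivative elsewhere, so it is strictly increasing. The radius comes from transversality alone and
serves all `u`. -/
theorem eventually_sign_chartOp {L : ℝ → Lagr K} (hcont : ContinuousOn L (Set.Ioo (-1) 1))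
    (hdiff : ∀ t ∈ Set.Ioo (-1 : ℝ) 0 ∪ Set.Ioo 0 1, PathDifferentiableAt L t)
    (hincr : IsIncreasingOn L (Set.Ioo (-1 : ℝ) 0 ∪ Set.Ioo 0 1)) (h₀ : Transversal M (L 0)) :
    ∀ᶠ t in 𝓝 (0 : ℝ), ∃ h : Transversal M (L t), ∀ u : (L 0).plane, u ≠ 0 →
      (0 < t → 0 < (inner ℂ u (chartOp (L 0) h u)).re) ∧
      (t < 0 → (inner ℂ u (chartOp (L 0) h u)).re < 0) := by
  have hc : ∀ t ∈ Set.Ioo (-1 : ℝ) 1, ContinuousAt L t := fun t ht =>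
    hcont.continuousAt (isOpen_Ioo.mem_nhds ht)
  obtain ⟨δ, hδ, hδT⟩ := Metric.eventually_nhds_iff_ball.1
    ((continuousAt_projAlong (hc 0 (by simp)) h₀).1.and (isOpen_Ioo.mem_nhds (by simp :
      (0 : ℝ) ∈ Set.Ioo (-1 : ℝ) 1)))
  rw [Metric.eventually_nhds_iff_ball]
  refine ⟨δ, hδ, fun t ht => ⟨(hδT t ht).1, fun u hu => ?_⟩⟩
  have hball : ∀ s : ℝ, |s| ≤ |t| → s ∈ Metric.ball (0 : ℝ) δ := by
    intro s hs
    rw [mem_ball_zero_iff, Real.norm_eq_abs] at *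
    exact hs.trans_lt ht
  set f : ℝ → ℝ := fun s => (omega (u : Phase K) (projAlong M (L s) u)).re with hf
  have hf0 : f 0 = 0 := by
    simp only [hf]
    rw [projAlong_eq_self h₀ u.2, (L 0).omega_eq_zero u.2 u.2, Complex.zero_re]
  have hfc : ∀ s ∈ Metric.ball (0 : ℝ) δ, ContinuousAt f s := by
    intro s hs
    have h1 := (continuousAt_projAlong (hc s (hδT s hs).2) (hδT s hs).1).2
    have h2 : Continuous fun C : Phase K →L[ℂ] Phase K =>
        (inner ℂ (u : Phase K) ((LinearMap.toContinuousLinearMap J : Phase K →L[ℂ] Phase K)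
          (C u))).re := by fun_prop
    have h3 : f = (fun C : Phase K →L[ℂ] Phase K =>
        (inner ℂ (u : Phase K) ((LinearMap.toContinuousLinearMap J : Phase K →L[ℂ] Phase K)
          (C u))).re) ∘ fun t => projAlong M (L t) := by
      ext s
      simp [hf, omega_eq_inner]
    rw [h3]
    exact ContinuousAt.comp h2.continuousAt h1
  have hfd : ∀ s ∈ Metric.ball (0 : ℝ) δ, s ≠ 0 → 0 < deriv f s := by
    intro s hs hs0
    have hmem : s ∈ Set.Ioo (-1 : ℝ) 0 ∪ Set.Ioo 0 1 := by
      rcases lt_or_gt_of_ne hs0 with h | h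
      · exact Or.inl ⟨(hδT s hs).2.1, h⟩
      · exact Or.inr ⟨h, (hδT s hs).2.2⟩
    rw [(hasDerivAt_omega_projAlong (hdiff s hmem) (hδT s hs).1 (u : Phase K)).deriv]
    -- If the projection of `u` vanished, `u` would lie in `M ∩ L 0 = 0`.
    refine hincr s hmem _ (projAlong_mem _ _ _) fun h0 => hu ?_
    have h1 := sub_projAlong_mem (hδT s hs).1 (u : Phase K)
    rw [h0, sub_zero] at h1
    exact Subtype.ext (h₀.eq_zero h1 u.2)
  rw [inner_chartOp_self h₀]
  change (0 < t → 0 < f t) ∧ (t < 0 → f t < 0)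
  constructor
  · intro h
    have hsub : ∀ s ∈ Set.Icc 0 t, s ∈ Metric.ball (0 : ℝ) δ := fun s hs => hball s (by
      rw [abs_of_nonneg hs.1, abs_of_pos h]
      exact hs.2)
    -- The derivative is needed only in the interior, which excludes `0`, where the path is merely
    -- continuous.
    have hmono := strictMonoOn_of_deriv_pos (convex_Icc 0 t)
      (fun s hs => (hfc s (hsub s hs)).continuousWithinAt) (fun s hs => by
        rw [interior_Icc] at hs
        exact hfd s (hsub s (Set.Ioo_subset_Icc_self hs)) hs.1.ne')
    rw [← hf0]
    exact hmono (Set.left_mem_Icc.2 h.le) (Set.right_mem_Icc.2 h.le) h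
  · intro h
    have hsub : ∀ s ∈ Set.Icc t 0, s ∈ Metric.ball (0 : ℝ) δ := fun s hs => hball s (by
      rw [abs_of_nonpos hs.2, abs_of_neg h]
      exact neg_le_neg hs.1)
    have hmono := strictMonoOn_of_deriv_pos (convex_Icc t 0)
      (fun s hs => (hfc s (hsub s hs)).continuousWithinAt) (fun s hs => by
        rw [interior_Icc] at hs
        exact hfd s (hsub s (Set.Ioo_subset_Icc_self hs)) hs.2.ne)
    rw [← hf0]
    exact hmono (Set.left_mem_Icc.2 h.le) (Set.right_mem_Icc.2 h.le) h

theorem eventually_chartOp_le {L : ℝ → Lagr K} (hcont : ContinuousAt L 0)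
    (h₀ : Transversal M (L 0)) {η : ℝ} (hη : 0 < η) :
    ∀ᶠ t in 𝓝 (0 : ℝ), ∀ (h : Transversal M (L t)) (u : (L 0).plane),
      |(inner ℂ u (chartOp (L 0) h u)).re| ≤ η * ‖u‖ ^ 2 := by
  set Jc : Phase K →L[ℂ] Phase K := LinearMap.toContinuousLinearMap J with hJc
  have h1 : ContinuousAt (fun t => ‖Jc * (projAlong M (L t) - projAlong M (L 0))‖) 0 :=
    (continuousAt_const.mul
      ((continuousAt_projAlong hcont h₀).2.sub continuousAt_const)).norm
  have h2 : ∀ᶠ t in 𝓝 (0 : ℝ), ‖Jc * (projAlong M (L t) - projAlong M (L 0))‖ < η :=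
    h1.eventually_lt continuousAt_const (by simpa using hη)
  filter_upwards [h2] with t ht h u
  have h3 : inner ℂ u (chartOp (L 0) h u)
      = inner ℂ (u : Phase K) ((Jc * (projAlong M (L t) - projAlong M (L 0))) u) := by
    have h4 := (L 0).omega_eq_zero u.2 u.2
    rw [inner_chartOp_self h₀]
    change _ = inner ℂ (u : Phase K) (J (projAlong M (L t) u - projAlong M (L 0) u))
    rw [← omega_eq_inner, omega_sub_right, projAlong_eq_self h₀ u.2, h4, sub_zero]
  rw [h3]
  calc _ ≤ ‖inner ℂ (u : Phase K) ((Jc * (projAlong M (L t) - projAlong M (L 0))) u)‖ :=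
        Complex.abs_re_le_norm _
    _ ≤ ‖(u : Phase K)‖ * ‖(Jc * (projAlong M (L t) - projAlong M (L 0))) u‖ :=
        norm_inner_le_norm _ _
    _ ≤ ‖(u : Phase K)‖ * (η * ‖(u : Phase K)‖) := by
        gcongr
        exact (ContinuousLinearMap.le_opNorm _ _).trans (by gcongr)
    _ = η * ‖u‖ ^ 2 := by
        rw [Submodule.coe_norm]
        ring

/-- The effect on the negative indices in a chart of moving the plane `L(0)` along the path. -/
theorem eventually_opNegIndex_chartOp {L : ℝ → Lagr K}
    (hcont : ContinuousOn L (Set.Ioo (-1) 1))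
    (hdiff : ∀ t ∈ Set.Ioo (-1 : ℝ) 0 ∪ Set.Ioo 0 1, PathDifferentiableAt L t)
    (hincr : IsIncreasingOn L (Set.Ioo (-1 : ℝ) 0 ∪ Set.Ioo 0 1)) (h₀ : Transversal M (L 0))
    {N : Lagr K} (hN : Transversal M N) :
    ∀ᶠ t in 𝓝 (0 : ℝ), ∀ h : Transversal M (L t),
      (0 < t → (opNegIndex (chartOp (L 0) hN - chartOp (L 0) h) : ℤ)
          = opNegIndex (chartOp (L 0) hN) + dimInter N (L 0) ∧
        opNegIndex (chartOp (L 0) h - chartOp (L 0) hN) = opNegIndex (-chartOp (L 0) hN)) ∧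
      (t < 0 → opNegIndex (chartOp (L 0) hN - chartOp (L 0) h) = opNegIndex (chartOp (L 0) hN) ∧
        (opNegIndex (chartOp (L 0) h - chartOp (L 0) hN) : ℤ)
          = opNegIndex (-chartOp (L 0) hN) + dimInter N (L 0)) := by
  have hS := chartOp_isSymmetric h₀ hN
  have hS' : (-chartOp (L 0) hN).IsSymmetric := by
    intro u v
    simp [hS u v]
  have hd : dimInter N (L 0) = Module.finrank ℂ (LinearMap.ker (-chartOp (L 0) hN)) := by
    rw [dimInter_eq_finrank_ker h₀ hN h₀, chartOp_self, zero_sub]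
  have hd' : dimInter N (L 0) = Module.finrank ℂ (LinearMap.ker (chartOp (L 0) hN)) := by
    have hk : LinearMap.ker (-chartOp (L 0) hN) = LinearMap.ker (chartOp (L 0) hN) := by
      ext u
      simp
    rw [hd, hk]
  obtain ⟨δ, hδ, hp⟩ := exists_opNegIndex_perturbation hS
  obtain ⟨δ', hδ', hp'⟩ := exists_opNegIndex_perturbation hS'
  have hc0 : ContinuousAt L 0 := hcont.continuousAt (isOpen_Ioo.mem_nhds (by simp))
  -- Halving the constants turns the non-strict bound of `eventually_chartOp_le` into the strict one
  -- required of a perturbation.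
  filter_upwards [eventually_sign_chartOp hcont hdiff hincr h₀,
    eventually_chartOp_le hc0 h₀ (half_pos hδ), eventually_chartOp_le hc0 h₀ (half_pos hδ')]
    with t ⟨h, hsign⟩ hle hle' _
  have hn : ∀ u : (L 0).plane, u ≠ 0 → 0 < ‖u‖ ^ 2 := fun u hu => by
    have := norm_pos_iff.2 hu
    positivity
  constructor
  · intro ht
    obtain ⟨-, h2⟩ := hp (chartOp (L 0) h) fun u hu => ⟨(hsign u hu).1 ht, by
      nlinarith [(abs_le.1 (hle h u)).2, mul_pos hδ (hn u hu)]⟩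
    obtain ⟨h3, -⟩ := hp' (chartOp (L 0) h) fun u hu => ⟨(hsign u hu).1 ht, by
      nlinarith [(abs_le.1 (hle' h u)).2, mul_pos hδ' (hn u hu)]⟩
    rw [neg_add_eq_sub] at h3
    refine ⟨?_, h3⟩
    rw [h2, hd']
    push_cast
    rfl
  · intro ht
    have hneg : ∀ u : (L 0).plane, (inner ℂ u ((-chartOp (L 0) h) u)).re
        = -(inner ℂ u (chartOp (L 0) h u)).re := by
      intro u
      rw [LinearMap.neg_apply, inner_neg_right, Complex.neg_re]
    obtain ⟨h2, -⟩ := hp (-chartOp (L 0) h) fun u hu => by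
      rw [hneg]
      exact ⟨neg_pos.2 ((hsign u hu).2 ht), by
        nlinarith [(abs_le.1 (hle h u)).1, mul_pos hδ (hn u hu)]⟩
    obtain ⟨-, h3⟩ := hp' (-chartOp (L 0) h) fun u hu => by
      rw [hneg]
      exact ⟨neg_pos.2 ((hsign u hu).2 ht), by
        nlinarith [(abs_le.1 (hle' h u)).1, mul_pos hδ' (hn u hu)]⟩
    rw [← sub_eq_add_neg] at h2
    rw [sub_neg_eq_add, neg_add_eq_sub] at h3
    refine ⟨h2, ?_⟩
    rw [h3, hd]
    push_cast
    rfl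

end Paths

end Duistermaat

/-! ### Assembly of the jump formulas. -/

namespace Duistermaat

theorem opNegIndex_chartOp_add_neg {K : Type*} [NormedAddCommGroup K] [InnerProductSpace ℂ K]
    [FiniteDimensional ℂ K] {B M L : Lagr K} (hB : Transversal M B) (h : Transversal M L) :
    (opNegIndex (chartOp B h) : ℤ) + opNegIndex (-chartOp B h) + dimInter L B
      = Module.finrank ℂ B.plane := by
  have h1 := opNegIndex_neg ((chartOp_isSymmetric hB hB).sub (chartOp_isSymmetric hB h))
  rw [dimInter_eq_finrank_ker hB h hB]
  rw [chartOp_self, zero_sub] at h1 ⊢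
  rw [neg_neg] at h1
  omega

end Duistermaat

theorem theorem3p2 {K : Type*} [NormedAddCommGroup K] [InnerProductSpace ℂ K]
    [FiniteDimensional ℂ K] (L : ℝ → Duistermaat.Lagr K)
    (hcont : ContinuousOn L (Set.Ioo (-1) 1))
    (hdiff : ∀ t ∈ Set.Ioo (-1 : ℝ) 0 ∪ Set.Ioo 0 1, Duistermaat.PathDifferentiableAt L t)
    (hincr : Duistermaat.IsIncreasingOn L (Set.Ioo (-1 : ℝ) 0 ∪ Set.Ioo 0 1))
    (L₁ L₂ L₃ : Duistermaat.Lagr K) :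
    (∃ ε : ℝ, 0 < ε ∧ ∀ t : ℝ, 0 < |t| → |t| < ε →
      (Duistermaat.iota (L t) L₂ L₃ = Duistermaat.iota (L 0) L₂ L₃ +
          (if t < 0 then 0 else Duistermaat.dimInter L₂ (L 0) - Duistermaat.dimInter L₃ (L 0))) ∧
      (Duistermaat.iota (L t) L₂ L₃ =
          if t < 0 then Duistermaat.iota (L 0) L₂ L₃ else Duistermaat.iota L₂ L₃ (L 0)) ∧
      (Duistermaat.iota L₁ (L t) L₃ = Duistermaat.iota L₁ (L 0) L₃ +
          (if t < 0 then Duistermaat.dimInter L₁ (L 0) else Duistermaat.dimInter L₃ (L 0))) ∧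
      (Duistermaat.iota L₁ L₂ (L t) = Duistermaat.iota L₁ L₂ (L 0) +
          (if t < 0 then Duistermaat.dimInter L₂ (L 0) - Duistermaat.dimInter L₁ (L 0) else 0)) ∧
      (Duistermaat.iota L₁ L₂ (L t) =
          if t < 0 then Duistermaat.iota (L 0) L₁ L₂ else Duistermaat.iota L₁ L₂ (L 0))) ∧
    ContinuousWithinAt (fun t => Duistermaat.iota (L t) L₂ L₃) (Set.Iic 0) 0 ∧
    ContinuousWithinAt (fun t => Duistermaat.iota L₁ L₂ (L t)) (Set.Ici 0) 0 := by
  obtain ⟨M, h₀, h₁, h₂, h₃⟩ := Duistermaat.exists_transversal_four (L 0) L₁ L₂ L₃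
  have hev : ∀ᶠ t in 𝓝 (0 : ℝ), t ≠ 0 →
      (Duistermaat.iota (L t) L₂ L₃ = Duistermaat.iota (L 0) L₂ L₃ +
          (if t < 0 then 0 else Duistermaat.dimInter L₂ (L 0) - Duistermaat.dimInter L₃ (L 0))) ∧
      (Duistermaat.iota (L t) L₂ L₃ =
          if t < 0 then Duistermaat.iota (L 0) L₂ L₃ else Duistermaat.iota L₂ L₃ (L 0)) ∧
      (Duistermaat.iota L₁ (L t) L₃ = Duistermaat.iota L₁ (L 0) L₃ +
          (if t < 0 then Duistermaat.dimInter L₁ (L 0) else Duistermaat.dimInter L₃ (L 0))) ∧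
      (Duistermaat.iota L₁ L₂ (L t) = Duistermaat.iota L₁ L₂ (L 0) +
          (if t < 0 then Duistermaat.dimInter L₂ (L 0) - Duistermaat.dimInter L₁ (L 0) else 0)) ∧
      (Duistermaat.iota L₁ L₂ (L t) =
          if t < 0 then Duistermaat.iota (L 0) L₁ L₂ else Duistermaat.iota L₁ L₂ (L 0)) := by
    filter_upwards [Duistermaat.eventually_sign_chartOp hcont hdiff hincr h₀,
      Duistermaat.eventually_opNegIndex_chartOp hcont hdiff hincr h₀ h₁,
      Duistermaat.eventually_opNegIndex_chartOp hcont hdiff hincr h₀ h₂,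
      Duistermaat.eventually_opNegIndex_chartOp hcont hdiff hincr h₀ h₃]
      with t ⟨h, _⟩ e₁ e₂ e₃ ht
    replace e₁ := e₁ h
    replace e₂ := e₂ h
    replace e₃ := e₃ h
    have n₁ := Duistermaat.opNegIndex_chartOp_add_neg h₀ h₁
    have n₂ := Duistermaat.opNegIndex_chartOp_add_neg h₀ h₂
    have n₃ := Duistermaat.opNegIndex_chartOp_add_neg h₀ h₃
    rw [Duistermaat.iota_eq_opNegIndex h₀ h h₂ h₃, Duistermaat.iota_eq_opNegIndex h₀ h₀ h₂ h₃,
      Duistermaat.iota_eq_opNegIndex h₀ h₂ h₃ h₀, Duistermaat.iota_eq_opNegIndex h₀ h₁ h h₃,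
      Duistermaat.iota_eq_opNegIndex h₀ h₁ h₀ h₃, Duistermaat.iota_eq_opNegIndex h₀ h₁ h₂ h,
      Duistermaat.iota_eq_opNegIndex h₀ h₁ h₂ h₀, Duistermaat.iota_eq_opNegIndex h₀ h₀ h₁ h₂,
      Duistermaat.chartOp_self h₀]
    simp only [sub_zero, zero_sub]
    rcases lt_or_gt_of_ne ht with hneg | hpos
    · obtain ⟨a₁, b₁⟩ := e₁.2 hneg
      obtain ⟨a₂, b₂⟩ := e₂.2 hneg
      obtain ⟨a₃, b₃⟩ := e₃.2 hneg
      simp only [if_pos hneg]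
      -- The relations `n₁`, `n₂`, `n₃` trade `n₋(-T)` for `n₋(T)`, which links the indices with `L
      -- 0` in different slots.
      omega
    · obtain ⟨a₁, b₁⟩ := e₁.1 hpos
      obtain ⟨a₂, b₂⟩ := e₂.1 hpos
      obtain ⟨a₃, b₃⟩ := e₃.1 hpos
      simp only [if_neg hpos.not_gt]
      omega
  refine ⟨?_, ?_, ?_⟩
  · obtain ⟨ε, hε, hball⟩ := Metric.eventually_nhds_iff_ball.1 hev
    refine ⟨ε, hε, fun t h0 ht => hball t ?_ (abs_pos.1 h0)⟩
    rwa [mem_ball_zero_iff, Real.norm_eq_abs]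
  -- One-sided continuity holds because the index is constant on that side near `0`, including at
  -- `0`.
  · refine continuousWithinAt_const.congr_of_eventuallyEq ?_ rfl
    filter_upwards [nhdsWithin_le_nhds hev, self_mem_nhdsWithin] with t ht hle
    rcases eq_or_ne t 0 with rfl | h0
    · rfl
    · rw [(ht h0).2.1, if_pos (lt_of_le_of_ne hle h0)]
  · refine continuousWithinAt_const.congr_of_eventuallyEq ?_ rfl
    filter_upwards [nhdsWithin_le_nhds hev, self_mem_nhdsWithin] with t ht hge
    rcases eq_or_ne t 0 with rfl | h0
    · rfl
    · rw [(ht h0).2.2.2.2, if_neg (not_lt.2 hge)]
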